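/- Let $m,K\ge 0$ be integers, $M=\mathbb R^m$ with the Euclidean norm, and consider Gaussian mixtures $p_0=\sum_{k=1}^K\pi_k\,\mathcal N(\mu_k,\Sigma_k)$ on $M$ with $\pi_k\ge 0$, $\sum_k\pi_k=1$, $\mu_k\in M$, $\Sigma_k$ positive definite. Write $d_k(x)^2=(x-\mu_k)^\top\Sigma_k^{-1}(x-\mu_k)$, let $\le$ between symmetric matrices be the Loewner order, and let $d_{LP}$ be the Lévy–Prokhorov distance of measures, which metrizes weak convergence of probability measures. *The maps.* The ordinary DAE trained for $p_0$ is $\Phi_t=\mathrm{Id}+t\,\nabla\log[W_{t/2}*p_0]$, where $W_t(z)=(4\pi t)^{-m/2}e^{-|z|^2/4t}$ (so $\Phi_0=\mathrm{Id}$). A continuous DAE trained for $p_0$ on $[0,T)$ is a family of measurable maps $\varphi_t:M\to M$ with $\varphi_0=\mathrm{Id}$ such that $p_t:=\varphi_{t\sharp}p_0$ has a positive differentiable density (also written $p_t$) whose score $\nabla\log p_t(x)$ is continuous in $(t,x)\in[0,T)\times M$, and $\partial_t\varphi_t(x)=\nabla\log p_t(\varphi_t(x))$ for all $x\in M$, $t\in[0,T)$.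 Their affine models at the $k$-th cluster are $$\Phi_{kt}(x)=(I+t\Sigma_k^{-1})^{-1}(x-\mu_k)+\mu_k,\qquad \varphi_{kt}(x)=\sqrt{I-2t\Sigma_k^{-1}}\,(x-\mu_k)+\mu_k .$$ *Well-separation.* Given positive definite matrices $S_1,\dots,S_K$, put $\gamma_k(x)=\pi_k\mathcal N(x;\mu_k,S_k)/\sum_j\pi_j\mathcal N(x;\mu_j,S_j)$. The mixture is $\varepsilon$-well-separated for $(S_k)$ with clusters $\Omega_1,\dots,\Omega_K\subseteq M$ if for every $k$ the set $\Omega_k$ is a neighborhood of $\mu_k$, $\mathcal N(\Omega_k;\mu_k,\Sigma_k)\ge 1-\varepsilon$, and $\gamma_k\ge 1-\varepsilon$ on $\Omega_k$. Then the following hold. 1. (Continuous DAE, exact pushforward.) If $\varphi$ is a continuous DAE trained for $p_0$ on $[0,T)$, then for every $t\in[0,T)$ such that all the $\Sigma_k-2tI$ are positive definite, $$\varphi_{t\sharp}p_0=\sum_{k=1}^K\pi_k\,\mathcal N(\mu_k,\Sigma_k-2tI).$$ 2. (Ordinary DAE, approximate pushforward.) For all $R,w,r,\delta>0$ there is $\varepsilon>0$,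 depending only on $m,K,R,w,r,\delta$, such that for every mixture with $\Sigma_k\le R\,I$ for all $k$ and every $t\in[0,R]$: if the mixture is $\varepsilon$-well-separated for $(\Sigma_k+tI)_k$ with clusters $\Omega_k$, then $$d_{LP}\Big(\Phi_{t\sharp}p_0,\ \sum_{k=1}^K\pi_k\,\mathcal N\big(\mu_k,\Sigma_k(I+t\Sigma_k^{-1})^{-2}\big)\Big)\le\delta,$$ and for every $k$ with $\pi_k\ge w$ and every $x\in\Omega_k$ with $d_k(x)\le r$, $|\Phi_t(x)-\Phi_{kt}(x)|\le\delta$. 3. (Continuous DAE on the clusters.) For all $\kappa,R,w,r,\delta>0$ there is $\varepsilon>0$, depending only on $m,K,\kappa,R,w,r,\delta$, such that for every mixture with $\Sigma_k\le R\,I$ for all $k$, every continuous DAE $\varphi$ trained for it on $[0,T)$ and every $t\in[0,T)$ with $\Sigma_k-2tI\ge\kappa I$ for all $k$: if there are sets $\Omega_1,\dots,\Omega_K$ such that for every $s\in[0,t]$ the mixture is $\varepsilon$-well-separated for $(\Sigma_k-2sI)_k$ with the clusters $\Omega_k$, then for every $k$ with $\pi_k\ge w$ and every $x$ with $d_k(x)\le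 r$, $|\varphi_t(x)-\varphi_{kt}(x)|\le\delta$. 4. (Contractions toward the centers.) For every mixture, every $k$ and every $t>0$, $\Phi_{kt}(\mu_k)=\mu_k$ and $\Phi_{kt}$ is Lipschitz with a constant less than $1$; if $\Sigma_k-2tI$ is positive definite, then also $\varphi_{kt}(\mu_k)=\mu_k$ and $\varphi_{kt}$ is Lipschitz with a constant less than $1$. -/

import Mathlib

open MeasureTheory ProbabilityTheory Set Topology
open scoped Matrix MatrixOrder NNReal ENNReal

noncomputable section

/-- The ground space `ℝᵐ` with its Euclidean norm. -/
abbrev Ground (m : ℕ) : Type := EuclideanSpace ℝ (Fin m)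

/-- The linear map `v ↦ A v` of the Euclidean space. -/
def matAct {m : ℕ} (A : Matrix (Fin m) (Fin m) ℝ) (v : Ground m) : Ground m :=
  WithLp.toLp 2 (A *ᵥ v.ofLp)

/-- The squared Mahalanobis distance `(x - μ)ᵀ S⁻¹ (x - μ)`. -/
def mahalanobisSq {m : ℕ} (μ : Ground m) (S : Matrix (Fin m) (Fin m) ℝ) (x : Ground m) : ℝ :=
  (x - μ).ofLp ⬝ᵥ (S⁻¹ *ᵥ (x - μ).ofLp)

/-- The value `N(x; μ, S)` at `x` of the Gaussian density (for positive definite `S`). -/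
def gaussianDensity {m : ℕ} (μ : Ground m) (S : Matrix (Fin m) (Fin m) ℝ) (x : Ground m) : ℝ :=
  (Real.sqrt ((2 * Real.pi) ^ m * S.det))⁻¹ * Real.exp (-(1 / 2) * mahalanobisSq μ S x)

/-- The heat kernel `W_t(z) = (4 π t)^{-m/2} exp (-|z|² / (4 t))`, for `t > 0`. -/
def heatKernel {m : ℕ} (t : ℝ) (z : Ground m) : ℝ :=
  (4 * Real.pi * t) ^ (-(m : ℝ) / 2) * Real.exp (-‖z‖ ^ 2 / (4 * t))

/-- The function `W_t * p`, for a measure `p`. -/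
def heatConv {m : ℕ} (t : ℝ) (p : Measure (Ground m)) (x : Ground m) : ℝ :=
  ∫ y, heatKernel t (x - y) ∂p

/-- The score `∇ log ρ`. -/
def score {m : ℕ} (ρ : Ground m → ℝ) (x : Ground m) : Ground m :=
  gradient (fun y => Real.log (ρ y)) x

/-- The (ordinary) denoising autoencoder `Φ_t = Id + t ∇ log (W_{t/2} * p₀)` trained for `p₀`. -/
def dae {m : ℕ} (p₀ : Measure (Ground m)) (t : ℝ) (x : Ground m) : Ground m :=
  x + t • score (heatConv (t / 2) p₀) x

/-- `φ` is a continuous denoising autoencoder trained for `p₀` on the time interval `[0, T)`: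
`φ_0 = Id`, the pushforward `p_t = φ_t♯ p₀` has a positive differentiable density `ρ_t` with a
score `∇ log ρ_t(x)` that is continuous in `(t, x)`, and every orbit `t ↦ φ_t(x)` solves
`dx/dt = ∇ log p_t (x)` on `[0, T)` (with the one-sided derivative at `t = 0`). -/
def IsContinuousDAE {m : ℕ} (p₀ : Measure (Ground m)) (T : ℝ) (φ : ℝ → Ground m → Ground m) :
    Prop :=
  (∀ x, φ 0 x = x) ∧
  (∀ t ∈ Ico 0 T, Measurable (φ t)) ∧
  ∃ ρ : ℝ → Ground m → ℝ,
    (∀ t ∈ Ico 0 T, (∀ x, 0 < ρ t x) ∧ Differentiable ℝ (ρ t) ∧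
      p₀.map (φ t) = volume.withDensity (fun x => ENNReal.ofReal (ρ t x))) ∧
    ContinuousOn (fun z : ℝ × Ground m => score (ρ z.1) z.2) (Ico 0 T ×ˢ univ) ∧
    ∀ x, ∀ t ∈ Ico 0 T, HasDerivWithinAt (fun s => φ s x) (score (ρ t) (φ t x)) (Ico 0 T) t

/-- The measure `∑ₖ πₖ N(μₖ, Sₖ)`. -/
def gaussianSum {m K : ℕ} (π : Fin K → ℝ) (μ : Fin K → Ground m)
    (S : Fin K → Matrix (Fin m) (Fin m) ℝ) : Measure (Ground m) :=
  ∑ k, ENNReal.ofReal (π k) • multivariateGaussian (μ k) (S k)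

/-- The parameters of a mixture of `K` nondegenerate Gaussians on `ℝᵐ`. -/
structure GaussianMixture (m K : ℕ) where
  /-- the mixing weights -/
  weight : Fin K → ℝ
  /-- the cluster centers -/
  mean : Fin K → Ground m
  /-- the covariance matrices -/
  cov : Fin K → Matrix (Fin m) (Fin m) ℝ
  weight_nonneg : ∀ k, 0 ≤ weight k
  weight_sum : ∑ k, weight k = 1
  cov_posDef : ∀ k, (cov k).PosDef

namespace GaussianMixture

variable {m K : ℕ}

/-- The distribution `p₀ = ∑ₖ πₖ N(μₖ, Σₖ)`. -/
def law (G : GaussianMixture m K) : Measure (Ground m) :=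
  gaussianSum G.weight G.mean G.cov

/-- `Σₖ - 2 t I`, the covariances for the continuous DAE. -/
def contCov (G : GaussianMixture m K) (t : ℝ) (k : Fin K) : Matrix (Fin m) (Fin m) ℝ :=
  G.cov k - (2 * t) • (1 : Matrix (Fin m) (Fin m) ℝ)

/-- `Σₖ + t I`, the covariances in the responsibilities of the ordinary DAE. -/
def noisyCov (G : GaussianMixture m K) (t : ℝ) (k : Fin K) : Matrix (Fin m) (Fin m) ℝ :=
  G.cov k + t • (1 : Matrix (Fin m) (Fin m) ℝ)

/-- The responsibility `πₖ N(x; μₖ, Sₖ) / ∑ⱼ πⱼ N(x; μⱼ, Sⱼ)`. -/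
def resp (G : GaussianMixture m K) (S : Fin K → Matrix (Fin m) (Fin m) ℝ) (k : Fin K)
    (x : Ground m) : ℝ :=
  G.weight k * gaussianDensity (G.mean k) (S k) x /
    ∑ j, G.weight j * gaussianDensity (G.mean j) (S j) x

/-- Well-separation up to the tolerance `ε` through the clusters `Ωₖ`: each `Ωₖ` is a neighborhood
of `μₖ`, it carries `N(μₖ, Σₖ)` up to mass `ε`, and on it the `k`-th responsibility is `1` up to
`ε` (so that there all the others are `0` up to `ε`, as the responsibilities sum to `1`). -/
def WellSeparated (G : GaussianMixture m K) (S : Fin K → Matrix (Fin m) (Fin m) ℝ)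
    (Ω : Fin K → Set (Ground m)) (ε : ℝ) : Prop :=
  ∀ k, Ω k ∈ 𝓝 (G.mean k) ∧
    ENNReal.ofReal (1 - ε) ≤ multivariateGaussian (G.mean k) (G.cov k) (Ω k) ∧
    ∀ x ∈ Ω k, 1 - ε ≤ G.resp S k x

/-- The affine map `x ↦ √(I - 2 t Σₖ⁻¹) (x - μₖ) + μₖ`. -/
def contAffine (G : GaussianMixture m K) (t : ℝ) (k : Fin K) (x : Ground m) : Ground m :=
  matAct (CFC.sqrt (1 - (2 * t) • (G.cov k)⁻¹)) (x - G.mean k) + G.mean k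

/-- The affine map `x ↦ (I + t Σₖ⁻¹)⁻¹ (x - μₖ) + μₖ`. -/
def daeAffine (G : GaussianMixture m K) (t : ℝ) (k : Fin K) (x : Ground m) : Ground m :=
  matAct (1 + t • (G.cov k)⁻¹)⁻¹ (x - G.mean k) + G.mean k

/-- `Σₖ (I + t Σₖ⁻¹)⁻²`, the covariances for the ordinary DAE. -/
def daeCov (G : GaussianMixture m K) (t : ℝ) (k : Fin K) : Matrix (Fin m) (Fin m) ℝ :=
  G.cov k * ((1 + t • (G.cov k)⁻¹)⁻¹) ^ 2

end GaussianMixture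

end

/-! Part 1. Mass moving with velocity ∇ log p_t obeys ∂_t p = -div(p ∇ log p) = -Δp, the backward
heat equation. On the Fourier side it forces the characteristic function of p_t to be exp(t|ξ|²)
times that of p_0, and the mixture with covariances Σ_k - 2tI has exactly this characteristic
function. `charFun_map_of_isContinuousDAE` makes this rigorous by testing against plane waves
truncated on large balls, since the score is only known to be continuous.

Parts 2 and 3. Both autoencoders are driven by scores of Gaussian mixtures: W_{t/2} is the density
of N(0, tI), so Φ_t involves the covariances S_k = Σ_k + tI, and part 1 identifies the velocity of φ
as the score with S_k = Σ_k - 2tI. By `score_mixDensity` such a score is the average of the vectors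
-S_k⁻¹(x - μ_k) weighted by the responsibilities γ_k. Where γ_k is nearly 1, it is nearly the affine
field of the k-th component, whose single step is Φ_kt and whose flow is φ_kt.

The difficulty lies in the terms γ_j S_j⁻¹(x - μ_j) of the other clusters: γ_j is small, but the
vector is unbounded because the centers may be arbitrarily far away. The remedy is interpolation. As
γ_j also decays like exp(-D_j/2) in the squared Mahalanobis distance D_j, a high power of γ_j
|S_j⁻¹(x - μ_j)| splits into a factor that supplies ε and a factor exp(-D_j) that absorbs the
polynomial growth.

For the ordinary DAE this gives `exists_norm_dae_sub_daeAffine_le`; coupling each component with its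
affine image then bounds the Lévy–Prokhorov distance. For the continuous DAE,
`exists_norm_score_sub_le` propagates the information from the center μ_k to a whole ball, and a
differential inequality with an exponential barrier keeps the true orbit near the affine one.

Part 4 holds because Σ_k⁻¹ is bounded below by a positive multiple of the identity. -/

noncomputable section

/-! ### Linear algebra of `matAct` -/

section MatAct

variable {m : ℕ}

theorem matAct_eq_toEuclideanCLM (A : Matrix (Fin m) (Fin m) ℝ) (v : Ground m) :
    matAct A v = Matrix.toEuclideanCLM (𝕜 := ℝ) A v := rfl

theorem matAct_add (A : Matrix (Fin m) (Fin m) ℝ) (v w : Ground m) :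
    matAct A (v + w) = matAct A v + matAct A w := by
  simp [matAct_eq_toEuclideanCLM]

theorem matAct_sub (A : Matrix (Fin m) (Fin m) ℝ) (v w : Ground m) :
    matAct A (v - w) = matAct A v - matAct A w := by
  simp [matAct_eq_toEuclideanCLM]

theorem matAct_smul (A : Matrix (Fin m) (Fin m) ℝ) (c : ℝ) (v : Ground m) :
    matAct A (c • v) = c • matAct A v := by
  simp [matAct_eq_toEuclideanCLM]

@[simp] theorem matAct_zero (A : Matrix (Fin m) (Fin m) ℝ) : matAct A (0 : Ground m) = 0 := by
  simp [matAct_eq_toEuclideanCLM]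

theorem add_matAct (A B : Matrix (Fin m) (Fin m) ℝ) (v : Ground m) :
    matAct (A + B) v = matAct A v + matAct B v := by
  simp [matAct_eq_toEuclideanCLM]

theorem sub_matAct (A B : Matrix (Fin m) (Fin m) ℝ) (v : Ground m) :
    matAct (A - B) v = matAct A v - matAct B v := by
  simp [matAct_eq_toEuclideanCLM]

theorem smul_matAct (c : ℝ) (A : Matrix (Fin m) (Fin m) ℝ) (v : Ground m) :
    matAct (c • A) v = c • matAct A v := by
  simp [matAct_eq_toEuclideanCLM]

@[simp] theorem one_matAct (v : Ground m) : matAct 1 v = v := by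
  simp [matAct_eq_toEuclideanCLM]

theorem mul_matAct (A B : Matrix (Fin m) (Fin m) ℝ) (v : Ground m) :
    matAct (A * B) v = matAct A (matAct B v) := by
  simp [matAct_eq_toEuclideanCLM]

@[fun_prop] theorem continuous_matAct (A : Matrix (Fin m) (Fin m) ℝ) :
    Continuous (fun v : Ground m => matAct A v) := by
  simp only [matAct_eq_toEuclideanCLM]; fun_prop

@[fun_prop] theorem measurable_matAct (A : Matrix (Fin m) (Fin m) ℝ) :
    Measurable (fun v : Ground m => matAct A v) := (continuous_matAct A).measurable

theorem inner_eq_dotProduct (x y : Ground m) : inner ℝ x y = x.ofLp ⬝ᵥ y.ofLp := by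
  rw [EuclideanSpace.inner_eq_star_dotProduct, dotProduct_comm]; rfl

theorem inner_matAct (A : Matrix (Fin m) (Fin m) ℝ) (x y : Ground m) :
    inner ℝ x (matAct A y) = x.ofLp ⬝ᵥ A *ᵥ y.ofLp := by
  rw [inner_eq_dotProduct]; rfl

theorem Matrix.IsHermitian.inner_matAct_left {A : Matrix (Fin m) (Fin m) ℝ} (hA : A.IsHermitian)
    (x y : Ground m) : inner ℝ (matAct A x) y = inner ℝ x (matAct A y) := by
  have h : Aᵀ = A := by
    rw [← Matrix.conjTranspose_eq_transpose_of_trivial]; exact hA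
  rw [real_inner_comm, inner_matAct, inner_matAct, Matrix.dotProduct_mulVec,
    ← Matrix.mulVec_transpose, h, dotProduct_comm]

theorem Matrix.PosSemidef.inner_matAct_nonneg {A : Matrix (Fin m) (Fin m) ℝ} (hA : A.PosSemidef)
    (x : Ground m) : 0 ≤ inner ℝ x (matAct A x) := by
  rw [inner_matAct]; simpa using hA.dotProduct_mulVec_nonneg x.ofLp

theorem Matrix.PosDef.inner_matAct_pos {A : Matrix (Fin m) (Fin m) ℝ} (hA : A.PosDef)
    {x : Ground m} (hx : x ≠ 0) : 0 < inner ℝ x (matAct A x) := by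
  rw [inner_matAct]
  simpa using hA.dotProduct_mulVec_pos (x := x.ofLp) (by simpa using hx)

theorem Matrix.PosDef.det_isUnit {A : Matrix (Fin m) (Fin m) ℝ} (hA : A.PosDef) :
    IsUnit A.det := hA.det_pos.ne'.isUnit

theorem Matrix.PosDef.matAct_inv_cancel {A : Matrix (Fin m) (Fin m) ℝ} (hA : A.PosDef)
    (x : Ground m) : matAct A⁻¹ (matAct A x) = x := by
  rw [← mul_matAct, Matrix.nonsing_inv_mul _ hA.det_isUnit, one_matAct]

theorem Matrix.PosDef.matAct_cancel_inv {A : Matrix (Fin m) (Fin m) ℝ} (hA : A.PosDef)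
    (x : Ground m) : matAct A (matAct A⁻¹ x) = x := by
  rw [← mul_matAct, Matrix.mul_nonsing_inv _ hA.det_isUnit, one_matAct]

/-! ### Mahalanobis distances and determinants under Loewner bounds. -/

theorem mahalanobisSq_eq_inner (μ : Ground m) (S : Matrix (Fin m) (Fin m) ℝ) (x : Ground m) :
    mahalanobisSq μ S x = inner ℝ (x - μ) (matAct S⁻¹ (x - μ)) := by
  rw [inner_matAct]; rfl

theorem Matrix.PosDef.mahalanobisSq_nonneg {S : Matrix (Fin m) (Fin m) ℝ} (hS : S.PosDef)
    (μ x : Ground m) : 0 ≤ mahalanobisSq μ S x := by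
  rw [mahalanobisSq_eq_inner]; exact hS.inv.posSemidef.inner_matAct_nonneg _

/-- A symmetric square root acts isometrically for the quadratic form. -/
theorem norm_matAct_sqrt_sq {A : Matrix (Fin m) (Fin m) ℝ} (hA : A.PosSemidef) (x : Ground m) :
    ‖matAct (CFC.sqrt A) x‖ ^ 2 = inner ℝ x (matAct A x) := by
  have hB : (CFC.sqrt A).PosSemidef := Matrix.nonneg_iff_posSemidef.1 (CFC.sqrt_nonneg A)
  rw [← real_inner_self_eq_norm_sq, hB.1.inner_matAct_left, ← mul_matAct,
    CFC.sqrt_mul_sqrt_self A hA.nonneg]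

/-- The form inequality A ≤ R I is applied to √A x, using A = √A √A. -/
theorem norm_sq_matAct_le_of_le {A : Matrix (Fin m) (Fin m) ℝ} {R : ℝ} (hA : A.PosSemidef)
    (hR : (R • (1 : Matrix (Fin m) (Fin m) ℝ) - A).PosSemidef) (x : Ground m) :
    ‖matAct A x‖ ^ 2 ≤ R * inner ℝ x (matAct A x) := by
  have h1 : matAct A x = matAct (CFC.sqrt A) (matAct (CFC.sqrt A) x) := by
    rw [← mul_matAct, CFC.sqrt_mul_sqrt_self A hA.nonneg]
  have h2 := hR.inner_matAct_nonneg (matAct (CFC.sqrt A) x)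
  rw [sub_matAct, smul_matAct, one_matAct, inner_sub_right, inner_smul_right,
    real_inner_self_eq_norm_sq, norm_matAct_sqrt_sq hA] at h2
  rw [h1, norm_matAct_sqrt_sq hA, ← h1]
  linarith

theorem inner_matAct_le_of_le {A : Matrix (Fin m) (Fin m) ℝ} {R : ℝ}
    (hR : (R • (1 : Matrix (Fin m) (Fin m) ℝ) - A).PosSemidef) (x : Ground m) :
    inner ℝ x (matAct A x) ≤ R * ‖x‖ ^ 2 := by
  have h2 := hR.inner_matAct_nonneg x
  rw [sub_matAct, smul_matAct, one_matAct, inner_sub_right, inner_smul_right,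
    real_inner_self_eq_norm_sq] at h2
  linarith

theorem le_inner_matAct_of_le {A : Matrix (Fin m) (Fin m) ℝ} {κ : ℝ}
    (hκ : (A - κ • (1 : Matrix (Fin m) (Fin m) ℝ)).PosSemidef) (x : Ground m) :
    κ * ‖x‖ ^ 2 ≤ inner ℝ x (matAct A x) := by
  have h2 := hκ.inner_matAct_nonneg x
  rw [sub_matAct, smul_matAct, one_matAct, inner_sub_right, inner_smul_right,
    real_inner_self_eq_norm_sq] at h2
  linarith

theorem norm_sq_le_mul_mahalanobisSq {S : Matrix (Fin m) (Fin m) ℝ} {R : ℝ} (hS : S.PosDef)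
    (hR : (R • (1 : Matrix (Fin m) (Fin m) ℝ) - S).PosSemidef) (μ x : Ground m) :
    ‖x - μ‖ ^ 2 ≤ R * mahalanobisSq μ S x := by
  have h := norm_sq_matAct_le_of_le hS.posSemidef hR (matAct S⁻¹ (x - μ))
  rwa [hS.matAct_cancel_inv, real_inner_comm, ← mahalanobisSq_eq_inner] at h

theorem mul_norm_sq_matAct_inv_le {S : Matrix (Fin m) (Fin m) ℝ} {κ : ℝ} (hS : S.PosDef)
    (hκ : (S - κ • (1 : Matrix (Fin m) (Fin m) ℝ)).PosSemidef) (μ x : Ground m) :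
    κ * ‖matAct S⁻¹ (x - μ)‖ ^ 2 ≤ mahalanobisSq μ S x := by
  have h := le_inner_matAct_of_le hκ (matAct S⁻¹ (x - μ))
  rwa [hS.matAct_cancel_inv, real_inner_comm, ← mahalanobisSq_eq_inner] at h

/-- With v = x - μ and u = S⁻¹v, Cauchy–Schwarz bounds the form by |v||u|, and κ|u|² is bounded by
the form itself; completing the square in |v| - κ|u| closes the loop. -/
theorem mul_mahalanobisSq_le_norm_sq {S : Matrix (Fin m) (Fin m) ℝ} {κ : ℝ} (hS : S.PosDef)
    (h0 : 0 ≤ κ) (hκ : (S - κ • (1 : Matrix (Fin m) (Fin m) ℝ)).PosSemidef) (μ x : Ground m) :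
    κ * mahalanobisSq μ S x ≤ ‖x - μ‖ ^ 2 := by
  have h := mul_norm_sq_matAct_inv_le hS hκ μ x
  have h1 : mahalanobisSq μ S x ≤ ‖x - μ‖ * ‖matAct S⁻¹ (x - μ)‖ := by
    rw [mahalanobisSq_eq_inner]; exact real_inner_le_norm _ _
  have h2 := mul_le_mul_of_nonneg_left h1 h0
  nlinarith [sq_nonneg (‖x - μ‖ - κ * ‖matAct S⁻¹ (x - μ)‖), mul_le_mul_of_nonneg_left h h0]

/-- Inversion reverses the Loewner order: the form of S is nonnegative at S'⁻¹v - S⁻¹v; expanding it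
and using S ≤ S' on the term quadratic in S'⁻¹v gives the claim. -/
theorem mahalanobisSq_anti {S S' : Matrix (Fin m) (Fin m) ℝ} (hS : S.PosDef) (hS' : S'.PosDef)
    (h : (S' - S).PosSemidef) (μ x : Ground m) :
    mahalanobisSq μ S' x ≤ mahalanobisSq μ S x := by
  rw [mahalanobisSq_eq_inner, mahalanobisSq_eq_inner]
  generalize x - μ = v
  have h1 := hS.posSemidef.inner_matAct_nonneg (matAct S'⁻¹ v - matAct S⁻¹ v)
  have h2 := h.inner_matAct_nonneg (matAct S'⁻¹ v)
  have h4 : inner ℝ (matAct S⁻¹ v) (matAct S (matAct S'⁻¹ v)) = inner ℝ v (matAct S'⁻¹ v) := by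
    rw [← hS.1.inner_matAct_left, hS.matAct_cancel_inv]
  rw [sub_matAct, hS'.matAct_cancel_inv, inner_sub_right,
    real_inner_comm v] at h2
  rw [matAct_sub, hS.matAct_cancel_inv, inner_sub_right, inner_sub_left, inner_sub_left, h4,
    real_inner_comm v, real_inner_comm v] at h1
  linarith

theorem mahalanobisSq_le_two_mul {S : Matrix (Fin m) (Fin m) ℝ} (hS : S.PosDef)
    (μ x y : Ground m) :
    mahalanobisSq μ S x ≤ 2 * mahalanobisSq μ S y + 2 * mahalanobisSq y S x := by
  have h := hS.inv.posSemidef.inner_matAct_nonneg ((y - μ) - (x - y))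
  have e : x - μ = (y - μ) + (x - y) := by abel
  simp only [mahalanobisSq_eq_inner]
  rw [e]
  simp only [matAct_sub, matAct_add, inner_sub_right, inner_sub_left, inner_add_left,
    inner_add_right] at h ⊢
  linarith

theorem Matrix.IsHermitian.eigenvalues_eq_inner {S : Matrix (Fin m) (Fin m) ℝ}
    (hS : S.IsHermitian) (i : Fin m) :
    hS.eigenvalues i = inner ℝ (hS.eigenvectorBasis i) (matAct S (hS.eigenvectorBasis i)) := by
  rw [hS.eigenvalues_eq, inner_matAct]; simp

theorem det_le_pow {S : Matrix (Fin m) (Fin m) ℝ} {R : ℝ} (hS : S.PosSemidef)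
    (hR : (R • (1 : Matrix (Fin m) (Fin m) ℝ) - S).PosSemidef) : S.det ≤ R ^ m := by
  rw [hS.1.det_eq_prod_eigenvalues]
  calc _ ≤ ∏ _i : Fin m, R := by
        refine Finset.prod_le_prod (fun i _ => by simpa using hS.eigenvalues_nonneg i)
          fun i _ => ?_
        have := inner_matAct_le_of_le hR (hS.1.eigenvectorBasis i)
        rw [← hS.1.eigenvalues_eq_inner, hS.1.eigenvectorBasis.norm_eq_one] at this
        simpa using this
    _ = _ := by simp

theorem pow_le_det {S : Matrix (Fin m) (Fin m) ℝ} {κ : ℝ} (h0 : 0 ≤ κ) (hS : S.IsHermitian)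
    (hκ : (S - κ • (1 : Matrix (Fin m) (Fin m) ℝ)).PosSemidef) : κ ^ m ≤ S.det := by
  rw [hS.det_eq_prod_eigenvalues]
  calc _ = ∏ _i : Fin m, κ := by simp
    _ ≤ _ := by
        refine Finset.prod_le_prod (fun i _ => h0) fun i _ => ?_
        have := le_inner_matAct_of_le hκ (hS.eigenvectorBasis i)
        rw [← hS.eigenvalues_eq_inner, hS.eigenvectorBasis.norm_eq_one] at this
        simpa using this

theorem posSemidef_smul_one {c : ℝ} (hc : 0 ≤ c) :
    (c • (1 : Matrix (Fin m) (Fin m) ℝ)).PosSemidef := Matrix.PosSemidef.one.smul hc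

/-- The constant is the minimum of the quadratic form on the unit sphere, which is compact but empty
in dimension zero. -/
theorem Matrix.PosDef.exists_le {S : Matrix (Fin m) (Fin m) ℝ} (hS : S.PosDef) :
    ∃ c > 0, ∀ x : Ground m, c * ‖x‖ ^ 2 ≤ inner ℝ x (matAct S x) := by
  rcases (Metric.sphere (0 : Ground m) 1).eq_empty_or_nonempty with h | h
  · refine ⟨1, one_pos, fun x => ?_⟩
    have hx : x = 0 := by
      by_contra hx
      have : ‖x‖⁻¹ • x ∈ Metric.sphere (0 : Ground m) 1 := by
        simp [norm_smul, inv_mul_cancel₀ (norm_ne_zero_iff.2 hx)]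
      rw [h] at this; exact this
    simp [hx]
  · obtain ⟨x₀, hx₀, hmin⟩ := (isCompact_sphere (0 : Ground m) 1).exists_isMinOn h
      (f := fun x => inner ℝ x (matAct S x)) (by fun_prop)
    have hne : x₀ ≠ 0 := by
      rintro rfl; simp at hx₀
    refine ⟨_, hS.inner_matAct_pos hne, fun x => ?_⟩
    rcases eq_or_ne x 0 with rfl | hx
    · simp
    have hn : ‖x‖ ≠ 0 := norm_ne_zero_iff.2 hx
    have := hmin (a := ‖x‖⁻¹ • x) (by simp [norm_smul, inv_mul_cancel₀ hn])
    simp only [mem_ofPred_eq, matAct_smul, inner_smul_left, inner_smul_right] at this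
    have h2 := mul_le_mul_of_nonneg_right this (sq_nonneg ‖x‖)
    calc _ ≤ _ := h2
      _ = _ := by simp; field_simp

/-- A map that shrinks squared norms of differences by a factor below one is a contraction. -/
theorem contractingWith_of_norm_sq_le {f : Ground m → Ground m} {a : ℝ} (ha : a < 1)
    (h : ∀ x y, ‖f x - f y‖ ^ 2 ≤ a * ‖x - y‖ ^ 2) : ∃ q : NNReal, ContractingWith q f := by
  refine ⟨(Real.sqrt a).toNNReal, ?_, ?_⟩
  · rw [Real.toNNReal_lt_one]
    simpa using (Real.sqrt_lt' one_pos).2 (by simpa using ha)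
  · refine LipschitzWith.of_dist_le_mul fun x y => ?_
    rw [dist_eq_norm, dist_eq_norm, Real.coe_toNNReal _ (Real.sqrt_nonneg a)]
    -- A negative `a` is possible when the space is a point; then the square root is `0` by
    -- convention.
    have h1 : a ≤ Real.sqrt a ^ 2 := by
      rcases le_total 0 a with h0 | h0
      · rw [Real.sq_sqrt h0]
      · exact h0.trans (sq_nonneg _)
    refine abs_le_of_sq_le_sq' ?_ (by positivity) |>.2
    rw [mul_pow]
    exact (h x y).trans (mul_le_mul_of_nonneg_right h1 (sq_nonneg _))

end MatAct

/-! ### The affine models are contractions. -/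

section Contractions

variable {m K : ℕ}

theorem posDef_one_add_smul_inv {S : Matrix (Fin m) (Fin m) ℝ} (hS : S.PosDef) {t : ℝ}
    (ht : 0 ≤ t) : (1 + t • S⁻¹).PosDef :=
  Matrix.PosDef.one.add_posSemidef (hS.inv.posSemidef.smul ht)

theorem posDef_add_smul_one {S : Matrix (Fin m) (Fin m) ℝ} (hS : S.PosDef) {t : ℝ}
    (ht : 0 ≤ t) : (S + t • (1 : Matrix (Fin m) (Fin m) ℝ)).PosDef :=
  hS.add_posSemidef (posSemidef_smul_one ht)

/-- `I - c S⁻¹` is positive semidefinite when `S - c I` is and `S` is positive definite. -/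
theorem posSemidef_one_sub_smul_inv {S : Matrix (Fin m) (Fin m) ℝ} (hS : S.PosDef) {c : ℝ}
    (h : (S - c • (1 : Matrix (Fin m) (Fin m) ℝ)).PosSemidef) : (1 - c • S⁻¹).PosSemidef := by
  have hB : (CFC.sqrt S⁻¹).PosSemidef := Matrix.nonneg_iff_posSemidef.1 (CFC.sqrt_nonneg _)
  have hBB := CFC.sqrt_mul_sqrt_self S⁻¹ hS.inv.posSemidef.nonneg
  set B := CFC.sqrt S⁻¹
  -- Conjugation by B = √(S⁻¹) turns S into I and c I into c S⁻¹, so it carries the hypothesis to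
  -- the conclusion.
  have hSB : B * S * B = 1 := by
    have hu : IsUnit B.det := by
      have := hS.inv.det_isUnit
      rw [← hBB, Matrix.det_mul] at this
      exact isUnit_of_mul_isUnit_left this
    have h1 : B * (B * S * B) = B := by
      rw [← mul_assoc, ← mul_assoc, hBB, Matrix.nonsing_inv_mul _ hS.det_isUnit, one_mul]
    calc B * S * B = B⁻¹ * (B * (B * S * B)) := by
          rw [← mul_assoc B⁻¹, Matrix.nonsing_inv_mul _ hu, one_mul]
      _ = 1 := by rw [h1, Matrix.nonsing_inv_mul _ hu]
  have := h.mul_mul_conjTranspose_same B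
  rw [hB.1, mul_sub, sub_mul, hSB] at this
  simpa [hBB] using this

namespace GaussianMixture

/-- If w is the image of x - y, then x - y = w + tΣ⁻¹w, whose squared norm is at least (1 + 2tc)|w|²
when c bounds Σ⁻¹ from below. -/
theorem contractingWith_daeAffine (G : GaussianMixture m K) {t : ℝ} (ht : 0 < t) (k : Fin K) :
    ∃ q : NNReal, ContractingWith q (G.daeAffine t k) := by
  have hS := G.cov_posDef k
  have hA := posDef_one_add_smul_inv hS ht.le
  obtain ⟨c, hc, hle⟩ := hS.inv.exists_le
  have hpos : 0 < 1 + 2 * t * c := by positivity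
  refine contractingWith_of_norm_sq_le (a := (1 + 2 * t * c)⁻¹)
    (inv_lt_one_of_one_lt₀ (by linarith [mul_pos ht hc])) fun x y => ?_
  have e : G.daeAffine t k x - G.daeAffine t k y = matAct (1 + t • (G.cov k)⁻¹)⁻¹ (x - y) := by
    simp only [daeAffine, matAct_sub]; abel
  set w := matAct (1 + t • (G.cov k)⁻¹)⁻¹ (x - y) with hw
  have hxy : x - y = w + t • matAct (G.cov k)⁻¹ w := by
    rw [← hA.matAct_cancel_inv (x - y), ← hw, add_matAct, smul_matAct, one_matAct]
  rw [e, hxy, norm_add_sq_real, inner_smul_right]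
  have h1 := mul_le_mul_of_nonneg_left (hle w) ht.le
  rw [inv_mul_eq_div, le_div_iff₀ hpos]
  nlinarith [sq_nonneg ‖t • matAct (G.cov k)⁻¹ w‖]

/-- The squared norm of √A v is ⟨v, A v⟩, and A = I - 2tΣ⁻¹ is at most (1 - 2tc) I. -/
theorem contractingWith_contAffine (G : GaussianMixture m K) {t : ℝ} (ht : 0 < t) (k : Fin K)
    (h : (G.contCov t k).PosDef) : ∃ q : NNReal, ContractingWith q (G.contAffine t k) := by
  have hS := G.cov_posDef k
  have hA := posSemidef_one_sub_smul_inv hS h.posSemidef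
  obtain ⟨c, hc, hle⟩ := hS.inv.exists_le
  refine contractingWith_of_norm_sq_le (a := 1 - 2 * t * c)
    (by linarith [mul_pos ht hc]) fun x y => ?_
  have e : G.contAffine t k x - G.contAffine t k y
      = matAct (CFC.sqrt (1 - (2 * t) • (G.cov k)⁻¹)) (x - y) := by
    simp only [contAffine, matAct_sub]; abel
  rw [e, norm_matAct_sqrt_sq hA, sub_matAct, smul_matAct, one_matAct, inner_sub_right,
    inner_smul_right, real_inner_self_eq_norm_sq]
  have h1 := mul_le_mul_of_nonneg_left (hle (x - y)) ht.le
  linarith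

end GaussianMixture

end Contractions

/-! ### Gaussian densities -/

section GaussianDensity

variable {m : ℕ}

@[fun_prop] theorem continuous_mahalanobisSq (μ : Ground m) (S : Matrix (Fin m) (Fin m) ℝ) :
    Continuous (mahalanobisSq μ S) := by
  have : mahalanobisSq μ S = fun x => inner ℝ (x - μ) (matAct S⁻¹ (x - μ)) :=
    funext fun x => mahalanobisSq_eq_inner μ S x
  rw [this]; fun_prop

@[fun_prop] theorem continuous_gaussianDensity (μ : Ground m) (S : Matrix (Fin m) (Fin m) ℝ) :
    Continuous (gaussianDensity μ S) := by
  unfold gaussianDensity; fun_prop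

theorem gaussianDensity_pos (μ : Ground m) {S : Matrix (Fin m) (Fin m) ℝ} (hS : S.PosDef)
    (x : Ground m) : 0 < gaussianDensity μ S x := by
  have := hS.det_pos
  unfold gaussianDensity; positivity

theorem gaussianDensity_zero_one (x : Ground m) :
    gaussianDensity 0 (1 : Matrix (Fin m) (Fin m) ℝ) x
      = (Real.sqrt ((2 * Real.pi) ^ m))⁻¹ * Real.exp (-(1 / 2) * ‖x‖ ^ 2) := by
  simp [gaussianDensity, mahalanobisSq_eq_inner]

/-- Both sides have the same characteristic function, by the Fourier integral of exp(-|x|²/2). -/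
theorem stdGaussian_eq_withDensity : stdGaussian (Ground m) =
    volume.withDensity (fun x => ENNReal.ofReal (gaussianDensity 0 1 x)) := by
  have hint : Integrable (fun x : Ground m => Real.exp (-(1 / 2 : ℝ) * ‖x‖ ^ 2)) := by
    have h := (GaussianFourier.integrable_cexp_neg_mul_sq_norm_add (V := Ground m)
      (b := (1 / 2 : ℂ)) (by norm_num) 0 0).norm
    refine h.congr (Filter.Eventually.of_forall fun x => ?_)
    simp only [Complex.norm_exp]
    congr 1
    simp [← Complex.ofReal_pow]
  have hint' : Integrable (fun x : Ground m => gaussianDensity 0 1 x) := by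
    simp only [gaussianDensity_zero_one]
    exact hint.const_mul _
  have hfin := isFiniteMeasure_withDensity_ofReal hint'.2
  refine Measure.ext_of_charFun ?_
  ext ξ
  rw [charFun_stdGaussian, charFun_apply, integral_withDensity_eq_integral_toReal_smul
    (by fun_prop) (by simp)]
  have h := GaussianFourier.integral_cexp_neg_mul_sq_norm_add (V := Ground m)
      (b := (1 / 2 : ℂ)) (by norm_num) Complex.I ξ
  have e : ∀ x : Ground m, (ENNReal.ofReal (gaussianDensity 0 1 x)).toReal •
        Complex.exp (inner ℝ x ξ * Complex.I)
      = ((Real.sqrt ((2 * Real.pi) ^ m))⁻¹ : ℝ) *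
        Complex.exp (-(1 / 2 : ℂ) * ‖x‖ ^ 2 + Complex.I * inner ℝ ξ x) := by
    intro x
    rw [ENNReal.toReal_ofReal (gaussianDensity_pos 0 Matrix.PosDef.one x).le,
      gaussianDensity_zero_one, Complex.exp_add, Complex.real_smul, Complex.ofReal_mul,
      Complex.ofReal_exp, mul_assoc, real_inner_comm, mul_comm Complex.I]
    push_cast; rfl
  simp_rw [e]
  rw [integral_const_mul, h]
  have e2 : (Real.pi / (1 / 2) : ℂ) ^ ((Module.finrank ℝ (Ground m) : ℂ) / 2)
      = (Real.sqrt ((2 * Real.pi) ^ m) : ℝ) := by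
    rw [Real.sqrt_eq_rpow, ← Real.rpow_natCast, ← Real.rpow_mul (by positivity),
      Complex.ofReal_cpow (by positivity)]
    congr 1
    · push_cast; ring
    · simp; ring
  have hne : Real.sqrt ((2 * Real.pi) ^ m) ≠ 0 := by positivity
  rw [e2, ← mul_assoc, ← Complex.ofReal_mul, inv_mul_cancel₀ hne, Complex.ofReal_one, one_mul]
  congr 1
  rw [Complex.I_sq]; ring

theorem posSemidef_sqrt (S : Matrix (Fin m) (Fin m) ℝ) : (CFC.sqrt S).PosSemidef :=
  Matrix.nonneg_iff_posSemidef.1 (CFC.sqrt_nonneg S)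

theorem Matrix.PosDef.det_sqrt_eq {S : Matrix (Fin m) (Fin m) ℝ} (hS : S.PosDef) :
    (CFC.sqrt S).det = Real.sqrt S.det := by
  rw [hS.posSemidef.det_sqrt]; simp

theorem Matrix.PosDef.posDef_sqrt {S : Matrix (Fin m) (Fin m) ℝ} (hS : S.PosDef) :
    (CFC.sqrt S).PosDef := by
  refine (posSemidef_sqrt S).posDef_iff_det_ne_zero.2 ?_
  rw [hS.det_sqrt_eq]
  exact (Real.sqrt_pos.2 hS.det_pos).ne'

theorem mahalanobisSq_add_sqrt {S : Matrix (Fin m) (Fin m) ℝ} (hS : S.PosDef) (μ z : Ground m) :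
    mahalanobisSq μ S (μ + matAct (CFC.sqrt S) z) = ‖z‖ ^ 2 := by
  have hB := hS.posDef_sqrt
  have hBB := CFC.sqrt_mul_sqrt_self S hS.posSemidef.nonneg
  have h1 : matAct S⁻¹ (matAct (CFC.sqrt S) z) = matAct (CFC.sqrt S)⁻¹ z := by
    have h2 : S⁻¹ = (CFC.sqrt S)⁻¹ * (CFC.sqrt S)⁻¹ := by rw [← Matrix.mul_inv_rev, hBB]
    rw [h2, mul_matAct, hB.matAct_inv_cancel]
  rw [mahalanobisSq_eq_inner, add_sub_cancel_left, h1, hB.1.inner_matAct_left,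
    hB.matAct_cancel_inv, real_inner_self_eq_norm_sq]

theorem multivariateGaussian_eq_map (μ : Ground m) (S : Matrix (Fin m) (Fin m) ℝ) :
    multivariateGaussian μ S
      = (stdGaussian (Ground m)).map (fun x => μ + matAct (CFC.sqrt S) x) := rfl

/-- Change of variables z ↦ μ + √S z: its Jacobian is √(det S), and it turns the Mahalanobis form
into |z|². -/
theorem multivariateGaussian_eq_withDensity (μ : Ground m) {S : Matrix (Fin m) (Fin m) ℝ}
    (hS : S.PosDef) : multivariateGaussian μ S =
      volume.withDensity (fun x => ENNReal.ofReal (gaussianDensity μ S x)) := by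
  have hd : 0 < Real.sqrt S.det := Real.sqrt_pos.2 hS.det_pos
  set L : Ground m →ₗ[ℝ] Ground m := Matrix.toLpLin 2 2 (CFC.sqrt S) with hL
  have hLdet : LinearMap.det L = Real.sqrt S.det := by
    rw [hL, LinearMap.det_toLpLin, hS.det_sqrt_eq]
  have hvol : (volume : Measure (Ground m)).map (fun x => μ + matAct (CFC.sqrt S) x)
      = ENNReal.ofReal (Real.sqrt S.det)⁻¹ • volume := by
    have h := Measure.map_linearMap_addHaar_eq_smul_addHaar (volume : Measure (Ground m)) (f := L)
      (by rw [hLdet]; exact hd.ne')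
    rw [hLdet, abs_of_pos (by positivity)] at h
    have h2 : (fun x => μ + matAct (CFC.sqrt S) x) = (fun x => μ + x) ∘ L := rfl
    rw [h2, ← Measure.map_map (by fun_prop) (by exact measurable_matAct _), h, Measure.map_smul,
      map_add_left_eq_self]
  have hdens : ∀ x, gaussianDensity 0 (1 : Matrix (Fin m) (Fin m) ℝ) x
      = Real.sqrt S.det * gaussianDensity μ S (μ + matAct (CFC.sqrt S) x) := by
    intro x
    rw [gaussianDensity_zero_one, gaussianDensity, mahalanobisSq_add_sqrt hS,
      Real.sqrt_mul (by positivity)]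
    field_simp
  rw [multivariateGaussian_eq_map]
  ext A hA
  have hmeas : Measurable (fun x => μ + matAct (CFC.sqrt S) x) := by fun_prop
  have hind : Measurable (A.indicator fun x => ENNReal.ofReal (gaussianDensity μ S x)) :=
    Measurable.indicator (by fun_prop) hA
  rw [Measure.map_apply hmeas hA, stdGaussian_eq_withDensity, withDensity_apply _ (hmeas hA),
    withDensity_apply _ hA, ← lintegral_indicator hA, ← lintegral_indicator (hmeas hA)]
  have e : ∀ x, ((fun x => μ + matAct (CFC.sqrt S) x) ⁻¹' A).indicator
        (fun x => ENNReal.ofReal (gaussianDensity 0 1 x)) x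
      = ENNReal.ofReal (Real.sqrt S.det) * (A.indicator
        (fun x => ENNReal.ofReal (gaussianDensity μ S x)) (μ + matAct (CFC.sqrt S) x)) := by
    intro x
    by_cases hx : μ + matAct (CFC.sqrt S) x ∈ A
    · rw [indicator_of_mem hx, indicator_of_mem (by exact hx), hdens, ENNReal.ofReal_mul hd.le]
    · rw [indicator_of_notMem hx, indicator_of_notMem (by exact hx), mul_zero]
  simp_rw [e]
  rw [lintegral_const_mul _ (by exact hind.comp hmeas), ← lintegral_map hind hmeas, hvol,
    lintegral_smul_measure, smul_eq_mul, ← mul_assoc, ← ENNReal.ofReal_mul hd.le,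
    mul_inv_cancel₀ hd.ne', ENNReal.ofReal_one, one_mul]

theorem heatKernel_half_eq {t : ℝ} (ht : 0 < t) (z : Ground m) :
    heatKernel (t / 2) z = gaussianDensity 0 (t • (1 : Matrix (Fin m) (Fin m) ℝ)) z := by
  have hinv : (t • (1 : Matrix (Fin m) (Fin m) ℝ))⁻¹ = t⁻¹ • 1 := by
    refine Matrix.inv_eq_right_inv ?_
    simp [smul_smul, inv_mul_cancel₀ ht.ne']
  rw [heatKernel, gaussianDensity, mahalanobisSq_eq_inner, hinv, smul_matAct, one_matAct]
  congr 1
  · rw [Matrix.det_smul, Matrix.det_one, mul_one, Fintype.card_fin, ← mul_pow,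
      Real.sqrt_eq_rpow, ← Real.rpow_natCast, ← Real.rpow_mul (by positivity),
      ← Real.rpow_neg (by positivity)]
    congr 1 <;> ring
  · rw [sub_zero, inner_smul_right, real_inner_self_eq_norm_sq]
    congr 1
    field_simp
    norm_num

theorem gaussianDensity_le {S : Matrix (Fin m) (Fin m) ℝ} (hS : S.PosDef) (μ x : Ground m) :
    gaussianDensity μ S x ≤ (Real.sqrt ((2 * Real.pi) ^ m * S.det))⁻¹ := by
  have := hS.mahalanobisSq_nonneg μ x
  refine mul_le_of_le_one_right (by positivity) (Real.exp_le_one_iff.2 (by linarith))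

theorem integrable_gaussianDensity_sub {S : Matrix (Fin m) (Fin m) ℝ} (hS : S.PosDef)
    (P : Measure (Ground m)) [IsFiniteMeasure P] (x : Ground m) :
    Integrable (fun y => gaussianDensity 0 S (x - y)) P := by
  refine Integrable.of_bound (C := (Real.sqrt ((2 * Real.pi) ^ m * S.det))⁻¹)
    (by fun_prop) (Filter.Eventually.of_forall fun y => ?_)
  rw [Real.norm_of_nonneg (gaussianDensity_pos _ hS _).le]
  exact gaussianDensity_le hS _ _

/-- Smoothing a Gaussian by a Gaussian adds the covariances. -/
theorem integral_gaussianDensity_sub (μ : Ground m) {S S' : Matrix (Fin m) (Fin m) ℝ}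
    (hS : S.PosDef) (hS' : S'.PosDef) (x : Ground m) :
    ∫ y, gaussianDensity 0 S' (x - y) ∂(multivariateGaussian μ S)
      = gaussianDensity μ (S + S') x := by
  set P := multivariateGaussian μ S with hP
  -- The convolution identity for the measures, read off from characteristic functions, only gives
  -- equality of the densities almost everywhere; continuity upgrades it to every point.
  have hcont : Continuous fun x => ∫ y, gaussianDensity 0 S' (x - y) ∂P := by
    refine continuous_of_dominated (bound := fun _ => (Real.sqrt ((2 * Real.pi) ^ m * S'.det))⁻¹)
      (fun x => by fun_prop) (fun x => Filter.Eventually.of_forall fun y => ?_)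
      (integrable_const _) (Filter.Eventually.of_forall fun y => by fun_prop)
    rw [Real.norm_of_nonneg (gaussianDensity_pos _ hS' _).le]
    exact gaussianDensity_le hS' _ _
  have hconv : P ∗ multivariateGaussian 0 S' = multivariateGaussian μ (S + S') := by
    refine Measure.ext_of_charFun ?_
    ext ξ
    rw [charFun_conv, hP, charFun_multivariateGaussian hS.posSemidef,
      charFun_multivariateGaussian hS'.posSemidef,
      charFun_multivariateGaussian (hS.add hS').posSemidef, ← Complex.exp_add]
    congr 1
    rw [Matrix.add_mulVec, dotProduct_add]
    simp only [inner_zero_right]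
    push_cast; ring
  rw [hP, multivariateGaussian_eq_withDensity μ hS, multivariateGaussian_eq_withDensity 0 hS',
    multivariateGaussian_eq_withDensity μ (hS.add hS'),
    conv_withDensity_eq_lconvolution (by fun_prop) (by fun_prop)] at hconv
  have hl : ∀ x, ((fun x => ENNReal.ofReal (gaussianDensity μ S x)) ⋆ₗ
        fun x => ENNReal.ofReal (gaussianDensity 0 S' x)) x
      = ENNReal.ofReal (∫ y, gaussianDensity 0 S' (x - y) ∂P) := by
    intro x
    rw [lconvolution_def, ofReal_integral_eq_lintegral_ofReal
      (integrable_gaussianDensity_sub hS' P x)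
      (Filter.Eventually.of_forall fun y => (gaussianDensity_pos _ hS' _).le), hP,
      multivariateGaussian_eq_withDensity μ hS,
      lintegral_withDensity_eq_lintegral_mul _ (by fun_prop) (by fun_prop)]
    refine lintegral_congr fun y => ?_
    rw [Pi.mul_apply, neg_add_eq_sub]
  have hl' := funext hl
  rw [hl'] at hconv
  have hfin : ∫⁻ x, ENNReal.ofReal (gaussianDensity μ (S + S') x) ≠ ⊤ := by
    rw [← setLIntegral_univ, ← withDensity_apply _ MeasurableSet.univ,
      ← multivariateGaussian_eq_withDensity μ (hS.add hS')]
    exact measure_ne_top _ _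
  have hae := (withDensity_eq_iff (by fun_prop)
    (hcont.measurable.ennreal_ofReal.aemeasurable) hfin).1 hconv.symm
  have heq := ((ENNReal.continuous_ofReal.comp (continuous_gaussianDensity μ (S + S'))).ae_eq_iff_eq
    volume (ENNReal.continuous_ofReal.comp hcont)).1 hae
  have := congrFun heq x
  exact ((ENNReal.ofReal_eq_ofReal_iff (gaussianDensity_pos _ (hS.add hS') _).le
    (integral_nonneg fun y => (gaussianDensity_pos _ hS' _).le)).1 this).symm

theorem hasFDerivAt_gaussianDensity (μ : Ground m) {S : Matrix (Fin m) (Fin m) ℝ} (hS : S.PosDef)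
    (x : Ground m) : HasFDerivAt (gaussianDensity μ S)
      (gaussianDensity μ S x • innerSL ℝ (-matAct S⁻¹ (x - μ))) x := by
  have h1 : HasFDerivAt (mahalanobisSq μ S) ((2 : ℝ) • innerSL ℝ (matAct S⁻¹ (x - μ))) x := by
    have e : mahalanobisSq μ S = fun y => inner ℝ (y - μ)
        (Matrix.toEuclideanCLM (𝕜 := ℝ) S⁻¹ (y - μ)) :=
      funext fun y => mahalanobisSq_eq_inner μ S y
    rw [e]
    have h := ((hasFDerivAt_id x).sub_const μ).inner ℝ
      ((Matrix.toEuclideanCLM (𝕜 := ℝ) S⁻¹).hasFDerivAt.comp x ((hasFDerivAt_id x).sub_const μ))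
    refine h.congr_fderiv ?_
    ext v
    have hsym := hS.inv.1.inner_matAct_left (x - μ) v
    rw [matAct_eq_toEuclideanCLM, matAct_eq_toEuclideanCLM] at hsym
    have hsym2 := real_inner_comm v (Matrix.toEuclideanCLM (𝕜 := ℝ) S⁻¹ (x - μ))
    simp [inner_sub_left, matAct_eq_toEuclideanCLM] at hsym hsym2 ⊢
    linarith
  have h2 := ((h1.const_mul (-(1 / 2))).exp).const_mul (Real.sqrt ((2 * Real.pi) ^ m * S.det))⁻¹
  refine h2.congr_fderiv ?_
  ext v
  simp [gaussianDensity]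
  ring

/-- Gaussians are mapped to Gaussians by affine maps with symmetric linear part. -/
theorem multivariateGaussian_map_affine (μ : Ground m) {S A : Matrix (Fin m) (Fin m) ℝ}
    (hS : S.PosSemidef) (hA : A.IsHermitian) :
    (multivariateGaussian μ S).map (fun x => matAct A (x - μ) + μ)
      = multivariateGaussian μ (A * S * A) := by
  have hmeas : Measurable fun x : Ground m => matAct A (x - μ) + μ := by fun_prop
  have := Measure.isProbabilityMeasure_map (μ := multivariateGaussian μ S) hmeas.aemeasurable
  have hASA : (A * S * A).PosSemidef := by
    have := hS.mul_mul_conjTranspose_same A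
    rwa [hA] at this
  refine Measure.ext_of_charFun ?_
  ext ξ
  rw [charFun_apply, integral_map hmeas.aemeasurable (by fun_prop)]
  have e : ∀ x : Ground m, Complex.exp (inner ℝ (matAct A (x - μ) + μ) ξ * Complex.I)
      = Complex.exp (inner ℝ (μ - matAct A μ) ξ * Complex.I) *
        Complex.exp (inner ℝ x (matAct A ξ) * Complex.I) := by
    intro x
    rw [← Complex.exp_add, ← hA.inner_matAct_left, ← add_mul, ← Complex.ofReal_add, matAct_sub,
      ← inner_add_left]
    congr 4; abel
  simp_rw [e]
  rw [integral_const_mul, ← charFun_apply, charFun_multivariateGaussian hS,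
    charFun_multivariateGaussian hASA, ← Complex.exp_add]
  congr 1
  have h1 : inner ℝ (μ - matAct A μ) ξ + inner ℝ (matAct A ξ) μ = inner ℝ ξ μ := by
    rw [inner_sub_left, hA.inner_matAct_left, real_inner_comm μ (matAct A ξ), real_inner_comm ξ μ]
    ring
  have h2 : (matAct A ξ).ofLp ⬝ᵥ S *ᵥ (matAct A ξ).ofLp = ξ.ofLp ⬝ᵥ (A * S * A) *ᵥ ξ.ofLp := by
    rw [← inner_matAct, ← inner_matAct, hA.inner_matAct_left, mul_matAct, mul_matAct]
  rw [h2, ← h1]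
  push_cast; ring

/-- In Mahalanobis distance the Gaussian tail does not depend on μ and S, which allows ε to depend
on the dimension only. -/
theorem multivariateGaussian_mahalanobisSq_gt (μ : Ground m) {S : Matrix (Fin m) (Fin m) ℝ}
    (hS : S.PosDef) {r : ℝ} (hr : 0 ≤ r) :
    multivariateGaussian μ S {x | r ^ 2 < mahalanobisSq μ S x}
      = stdGaussian (Ground m) {x | r < ‖x‖} := by
  have hm : MeasurableSet {x | r ^ 2 < mahalanobisSq μ S x} :=
    measurableSet_lt (by fun_prop) (by fun_prop)
  rw [multivariateGaussian_eq_map, Measure.map_apply (by fun_prop) hm]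
  congr 1
  ext z
  simp only [mem_preimage, mem_ofPred_eq, mahalanobisSq_add_sqrt hS]
  exact pow_lt_pow_iff_left₀ hr (norm_nonneg z) two_ne_zero

theorem exists_stdGaussian_norm_gt_le (m : ℕ) {δ : ℝ} (hδ : 0 < δ) :
    ∃ r > 0, stdGaussian (Ground m) {x | r < ‖x‖} ≤ ENNReal.ofReal δ := by
  have h := tendsto_measure_norm_gt_of_isTightMeasureSet
    (isTightMeasureSet_singleton (μ := stdGaussian (Ground m)))
  simp only [mem_singleton_iff, iSup_iSup_eq_left] at h
  have h2 := h.eventually_le_const (ENNReal.ofReal_pos.2 hδ)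
  obtain ⟨r, hr, hr0⟩ := (h2.and (Filter.eventually_gt_atTop 0)).exists
  exact ⟨r, hr0, hr⟩

end GaussianDensity

/-! ### Mixtures -/

namespace GaussianMixture

variable {m K : ℕ} (G : GaussianMixture m K) (S : Fin K → Matrix (Fin m) (Fin m) ℝ)

/-- The density `∑ₖ πₖ N(x; μₖ, Sₖ)`. -/
def mixDensity (x : Ground m) : ℝ := ∑ k, G.weight k * gaussianDensity (G.mean k) (S k) x

variable {S}

theorem weight_le_one (k : Fin K) : G.weight k ≤ 1 := by
  rw [← G.weight_sum]
  exact Finset.single_le_sum (fun j _ => G.weight_nonneg j) (Finset.mem_univ k)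

theorem mixDensity_pos (hS : ∀ k, (S k).PosDef) (x : Ground m) : 0 < G.mixDensity S x := by
  obtain ⟨k, hk⟩ : ∃ k, 0 < G.weight k := by
    by_contra! h
    have := Finset.sum_nonpos fun k (_ : k ∈ Finset.univ) => h k
    rw [G.weight_sum] at this
    linarith
  exact Finset.sum_pos' (fun j _ => mul_nonneg (G.weight_nonneg j)
    (gaussianDensity_pos _ (hS j) x).le) ⟨k, Finset.mem_univ k,
      mul_pos hk (gaussianDensity_pos _ (hS k) x)⟩

variable (S) in
theorem continuous_mixDensity : Continuous (G.mixDensity S) := by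
  unfold mixDensity; fun_prop

variable (S) in
theorem resp_eq (k : Fin K) (x : Ground m) : G.resp S k x =
    G.weight k * gaussianDensity (G.mean k) (S k) x / G.mixDensity S x := rfl

theorem resp_nonneg (hS : ∀ k, (S k).PosDef) (k : Fin K) (x : Ground m) : 0 ≤ G.resp S k x :=
  div_nonneg (mul_nonneg (G.weight_nonneg k) (gaussianDensity_pos _ (hS k) x).le)
    (G.mixDensity_pos hS x).le

theorem sum_resp (hS : ∀ k, (S k).PosDef) (x : Ground m) : ∑ k, G.resp S k x = 1 := by
  simp only [resp_eq, ← Finset.sum_div]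
  exact div_self (G.mixDensity_pos hS x).ne'

theorem resp_le_one (hS : ∀ k, (S k).PosDef) (k : Fin K) (x : Ground m) : G.resp S k x ≤ 1 := by
  rw [← G.sum_resp hS x]
  exact Finset.single_le_sum (fun j _ => G.resp_nonneg hS j x) (Finset.mem_univ k)

theorem gaussianSum_eq_withDensity (hS : ∀ k, (S k).PosDef) :
    gaussianSum G.weight G.mean S
      = volume.withDensity (fun x => ENNReal.ofReal (G.mixDensity S x)) := by
  ext A hA
  rw [withDensity_apply _ hA, gaussianSum, Measure.finsetSum_apply]
  have e : ∀ x, ENNReal.ofReal (G.mixDensity S x) = ∑ k, ENNReal.ofReal (G.weight k) *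
      ENNReal.ofReal (gaussianDensity (G.mean k) (S k) x) := by
    intro x
    rw [mixDensity, ENNReal.ofReal_sum_of_nonneg fun j _ => mul_nonneg (G.weight_nonneg j)
      (gaussianDensity_pos _ (hS j) x).le]
    exact Finset.sum_congr rfl fun k _ => ENNReal.ofReal_mul (G.weight_nonneg k)
  simp_rw [e]
  rw [lintegral_finsetSum _ fun k _ => by fun_prop]
  refine Finset.sum_congr rfl fun k _ => ?_
  rw [Measure.smul_apply, multivariateGaussian_eq_withDensity _ (hS k), withDensity_apply _ hA,
    lintegral_const_mul _ (by fun_prop), smul_eq_mul]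

instance isProbabilityMeasure_gaussianSum :
    IsProbabilityMeasure (gaussianSum G.weight G.mean S) := by
  refine ⟨?_⟩
  simp only [gaussianSum, Measure.finsetSum_apply, Measure.smul_apply, measure_univ, smul_eq_mul,
    mul_one]
  rw [← ENNReal.ofReal_sum_of_nonneg fun j _ => G.weight_nonneg j, G.weight_sum,
    ENNReal.ofReal_one]

instance isProbabilityMeasure_law : IsProbabilityMeasure G.law :=
  G.isProbabilityMeasure_gaussianSum

theorem integral_gaussianSum {E : Type*} [NormedAddCommGroup E] [NormedSpace ℝ E]
    (f : Ground m → E) (hf : ∀ k, Integrable f (multivariateGaussian (G.mean k) (S k))) :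
    ∫ x, f x ∂(gaussianSum G.weight G.mean S)
      = ∑ k, G.weight k • ∫ x, f x ∂(multivariateGaussian (G.mean k) (S k)) := by
  rw [gaussianSum, integral_finsetSum_measure
    fun k _ => (hf k).smul_measure ENNReal.ofReal_ne_top]
  refine Finset.sum_congr rfl fun k _ => ?_
  rw [integral_smul_measure, ENNReal.toReal_ofReal (G.weight_nonneg k)]

theorem heatConv_law {t : ℝ} (ht : 0 < t) :
    heatConv (t / 2) G.law = G.mixDensity (G.noisyCov t) := by
  ext x
  have h1 : (t • (1 : Matrix (Fin m) (Fin m) ℝ)).PosDef := Matrix.PosDef.one.smul ht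
  simp only [heatConv, heatKernel_half_eq ht]
  rw [law, integral_gaussianSum _ _ fun k => integrable_gaussianDensity_sub h1 _ _]
  refine Finset.sum_congr rfl fun k _ => ?_
  rw [integral_gaussianDensity_sub _ (G.cov_posDef k) h1, smul_eq_mul, noisyCov]

/-- Differentiating the logarithm divides each π_k ∇N_k by the mixture density, and ∇N_k = -N_k
S_k⁻¹(x - μ_k), so the responsibilities appear as weights. -/
theorem score_mixDensity (hS : ∀ k, (S k).PosDef) (x : Ground m) :
    score (G.mixDensity S) x = -∑ k, G.resp S k x • matAct (S k)⁻¹ (x - G.mean k) := by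
  have h : HasFDerivAt (G.mixDensity S) (∑ k, G.weight k • (gaussianDensity (G.mean k) (S k) x •
      innerSL ℝ (-matAct (S k)⁻¹ (x - G.mean k)))) x :=
    HasFDerivAt.fun_sum fun k _ => (hasFDerivAt_gaussianDensity _ (hS k) x).const_mul _
  have h2 := h.log (G.mixDensity_pos hS x).ne'
  refine HasGradientAt.gradient (hasGradientAt_iff_hasFDerivAt.2 (h2.congr_fderiv ?_))
  ext v
  simp only [resp_eq, InnerProductSpace.toDual_apply_apply, smul_apply,
    sum_apply, innerSL_apply_apply, inner_neg_left, sum_inner,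
    inner_smul_left, smul_eq_mul, Finset.mul_sum]
  rw [← Finset.sum_neg_distrib]
  refine Finset.sum_congr rfl fun k _ => ?_
  simp
  ring

end GaussianMixture

/-! ### The ordinary denoising autoencoder -/

section Ratio

variable {m K : ℕ}

/-- Squared comparison of two Gaussian densities with controlled determinants. -/
theorem gaussianDensity_sq_le {μ μ' : Ground m} {S S' : Matrix (Fin m) (Fin m) ℝ} {κ R : ℝ}
    (hκ : 0 < κ) (hR : 0 < R) (hdet : κ ^ m ≤ S.det) (hS' : S'.PosDef) (hdet' : S'.det ≤ R ^ m)
    (x : Ground m) :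
    gaussianDensity μ S x ^ 2 ≤ (R / κ) ^ m * Real.exp (mahalanobisSq μ' S' x) *
      Real.exp (-mahalanobisSq μ S x) * gaussianDensity μ' S' x ^ 2 := by
  have hdpos : 0 < S.det := lt_of_lt_of_le (by positivity) hdet
  have hdpos' := hS'.det_pos
  have e : ∀ (ν : Ground m) (Q : Matrix (Fin m) (Fin m) ℝ), 0 < Q.det →
      gaussianDensity ν Q x ^ 2
        = ((2 * Real.pi) ^ m * Q.det)⁻¹ * Real.exp (-mahalanobisSq ν Q x) := by
    intro ν Q hQ
    rw [gaussianDensity, mul_pow, inv_pow, Real.sq_sqrt (by positivity), ← Real.exp_nat_mul]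
    congr 2; push_cast; ring
  rw [e μ S hdpos, e μ' S' hdpos', Real.exp_neg (mahalanobisSq μ' S' x)]
  have h1 : ((2 * Real.pi) ^ m * S.det)⁻¹ ≤ (R / κ) ^ m * ((2 * Real.pi) ^ m * S'.det)⁻¹ := by
    rw [div_pow, inv_eq_one_div, inv_eq_one_div, div_mul_div_comm, mul_one,
      div_le_div_iff₀ (by positivity) (by positivity), one_mul]
    calc κ ^ m * ((2 * Real.pi) ^ m * S'.det) = (2 * Real.pi) ^ m * (κ ^ m * S'.det) := by ring
      _ ≤ (2 * Real.pi) ^ m * (S.det * R ^ m) := by gcongr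
      _ = _ := by ring
  calc _ ≤ (R / κ) ^ m * ((2 * Real.pi) ^ m * S'.det)⁻¹ * Real.exp (-mahalanobisSq μ S x) := by
        gcongr
    _ = _ := by
        have := (Real.exp_pos (mahalanobisSq μ' S' x)).ne'
        field_simp

/-- A responsibility is controlled by the ratio of the densities. -/
theorem GaussianMixture.resp_sq_le (G : GaussianMixture m K)
    {S : Fin K → Matrix (Fin m) (Fin m) ℝ} (hS : ∀ k, (S k).PosDef) {κ R w : ℝ} (hκ : 0 < κ)
    (hR : 0 < R) (hw : 0 < w) {j k : Fin K} (hdet : κ ^ m ≤ (S j).det)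
    (hdet' : (S k).det ≤ R ^ m) (hk : w ≤ G.weight k) (x : Ground m) :
    G.resp S j x ^ 2 ≤ G.weight j ^ 2 * ((R / κ) ^ m * Real.exp (mahalanobisSq (G.mean k) (S k) x) *
      Real.exp (-mahalanobisSq (G.mean j) (S j) x)) / w ^ 2 := by
  have hk0 := gaussianDensity_pos (G.mean k) (hS k) x
  have h1 : w * gaussianDensity (G.mean k) (S k) x ≤ G.mixDensity S x :=
    (mul_le_mul_of_nonneg_right hk hk0.le).trans (Finset.single_le_sum
      (f := fun k => G.weight k * gaussianDensity (G.mean k) (S k) x)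
      (fun i _ => mul_nonneg (G.weight_nonneg i) (gaussianDensity_pos _ (hS i) x).le)
      (Finset.mem_univ k))
  have h2 := gaussianDensity_sq_le (μ := G.mean j) (μ' := G.mean k) hκ hR hdet (hS k) hdet' x
  set A := (R / κ) ^ m * Real.exp (mahalanobisSq (G.mean k) (S k) x) *
      Real.exp (-mahalanobisSq (G.mean j) (S j) x)
  have hA : 0 ≤ A := by positivity
  rw [resp_eq, div_pow, div_le_div_iff₀ (pow_pos (G.mixDensity_pos hS x) 2) (by positivity)]
  calc (G.weight j * gaussianDensity (G.mean j) (S j) x) ^ 2 * w ^ 2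
      = G.weight j ^ 2 * (gaussianDensity (G.mean j) (S j) x ^ 2 * w ^ 2) := by ring
    _ ≤ G.weight j ^ 2 * ((A * gaussianDensity (G.mean k) (S k) x ^ 2) * w ^ 2) := by gcongr
    _ = G.weight j ^ 2 * A * (w * gaussianDensity (G.mean k) (S k) x) ^ 2 := by ring
    _ ≤ _ := by gcongr

theorem pow_mul_exp_neg_le {x : ℝ} (hx : 0 ≤ x) (n : ℕ) :
    x ^ n * Real.exp (-x) ≤ n.factorial := by
  have h := Real.pow_div_factorial_le_exp x hx n
  rw [div_le_iff₀ (by positivity)] at h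
  rw [Real.exp_neg, ← div_eq_mul_inv, div_le_iff₀ (Real.exp_pos x)]
  linarith

/-- Chooses one tolerance for two smallness requirements; |A| + 1 and |B| + 1 keep the divisions
legitimate whatever the signs. -/
theorem exists_pos_le_one_mul_le (A B : ℝ) {a b : ℝ} (ha : 0 < a) (hb : 0 < b) :
    ∃ ε : ℝ, 0 < ε ∧ ε ≤ 1 ∧ ε * A ≤ a ∧ ε * B ≤ b := by
  refine ⟨min 1 (min (a / (|A| + 1)) (b / (|B| + 1))), by positivity, min_le_left _ _, ?_, ?_⟩
  · calc _ ≤ min 1 (min (a / (|A| + 1)) (b / (|B| + 1))) * (|A| + 1) := by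
          gcongr; linarith [le_abs_self A]
      _ ≤ a / (|A| + 1) * (|A| + 1) := by
          gcongr; exact (min_le_right _ _).trans (min_le_left _ _)
      _ = a := by field_simp
  · calc _ ≤ min 1 (min (a / (|A| + 1)) (b / (|B| + 1))) * (|B| + 1) := by
          gcongr; linarith [le_abs_self B]
      _ ≤ b / (|B| + 1) * (|B| + 1) := by
          gcongr; exact (min_le_right _ _).trans (min_le_right _ _)
      _ = b := by field_simp

namespace GaussianMixture

variable (G : GaussianMixture m K)

theorem resp_le_of_ne {S : Fin K → Matrix (Fin m) (Fin m) ℝ} (hS : ∀ k, (S k).PosDef)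
    {j k : Fin K} (hjk : j ≠ k) {ε : ℝ} {x : Ground m} (h : 1 - ε ≤ G.resp S k x) :
    G.resp S j x ≤ ε := by
  have h1 := G.sum_resp hS x
  rw [← Finset.add_sum_erase _ _ (Finset.mem_univ k)] at h1
  have h2 := Finset.single_le_sum (fun i _ => G.resp_nonneg hS i x)
    (Finset.mem_erase.2 ⟨hjk, Finset.mem_univ j⟩)
  linarith

/-- The deviation of the mixture score from the score of one component. -/
theorem norm_score_sub_le {S : Fin K → Matrix (Fin m) (Fin m) ℝ} (hS : ∀ k, (S k).PosDef)
    (k : Fin K) (x : Ground m) :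
    ‖score (G.mixDensity S) x + matAct (S k)⁻¹ (x - G.mean k)‖ ≤
      (1 - G.resp S k x) * ‖matAct (S k)⁻¹ (x - G.mean k)‖ +
        ∑ j ∈ Finset.univ.erase k, G.resp S j x * ‖matAct (S j)⁻¹ (x - G.mean j)‖ := by
  rw [G.score_mixDensity hS, ← Finset.add_sum_erase _ _ (Finset.mem_univ k)]
  have e : -(G.resp S k x • matAct (S k)⁻¹ (x - G.mean k) +
        ∑ j ∈ Finset.univ.erase k, G.resp S j x • matAct (S j)⁻¹ (x - G.mean j)) +
        matAct (S k)⁻¹ (x - G.mean k)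
      = (1 - G.resp S k x) • matAct (S k)⁻¹ (x - G.mean k) -
        ∑ j ∈ Finset.univ.erase k, G.resp S j x • matAct (S j)⁻¹ (x - G.mean j) := by
    module
  rw [e]
  refine (norm_sub_le _ _).trans (add_le_add ?_ ((norm_sum_le _ _).trans (le_of_eq ?_)))
  · rw [norm_smul, Real.norm_of_nonneg (by linarith [G.resp_le_one hS k x])]
  · refine Finset.sum_congr rfl fun j _ => ?_
    rw [norm_smul, Real.norm_of_nonneg (G.resp_nonneg hS j x)]

theorem posDef_noisyCov {t : ℝ} (ht : 0 ≤ t) (k : Fin K) : (G.noisyCov t k).PosDef :=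
  posDef_add_smul_one (G.cov_posDef k) ht

/-- Since (I + tΣ⁻¹)⁻¹ = Σ(Σ + tI)⁻¹ = I - t(Σ + tI)⁻¹, the affine model is the step along the score
of the k-th smoothed component, directly comparable with Φ_t. -/
theorem daeAffine_eq {t : ℝ} (ht : 0 ≤ t) (k : Fin K) (x : Ground m) :
    G.daeAffine t k x = x - t • matAct (G.noisyCov t k)⁻¹ (x - G.mean k) := by
  have hS := G.cov_posDef k
  have hA := posDef_one_add_smul_inv hS ht
  have hN := G.posDef_noisyCov ht k
  have h : matAct (1 + t • (G.cov k)⁻¹)⁻¹ (x - G.mean k)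
      = (x - G.mean k) - t • matAct (G.noisyCov t k)⁻¹ (x - G.mean k) := by
    set v := x - G.mean k
    have e : v - t • matAct (G.noisyCov t k)⁻¹ v = matAct (G.cov k) (matAct (G.noisyCov t k)⁻¹ v) := by
      have h1 := hN.matAct_cancel_inv v
      conv_lhs => rw [← h1, hN.matAct_inv_cancel]
      conv_lhs => enter [1]; rw [noisyCov, add_matAct, smul_matAct, one_matAct]
      simp [noisyCov]
    rw [← hA.matAct_inv_cancel (v - t • matAct (G.noisyCov t k)⁻¹ v)]
    congr 1
    rw [e, add_matAct, smul_matAct, one_matAct, hS.matAct_inv_cancel, ← e]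
    abel
  rw [daeAffine, h]; abel

theorem dae_law {t : ℝ} (ht : 0 < t) (x : Ground m) :
    dae G.law t x = x + t • score (G.mixDensity (G.noisyCov t)) x := by
  rw [dae, G.heatConv_law ht]

theorem dae_zero (P : Measure (Ground m)) : dae P 0 = id := by
  ext1 x; simp [dae]

theorem daeAffine_zero (k : Fin K) : G.daeAffine 0 k = id := by
  ext1 x; simp [G.daeAffine_eq le_rfl]

theorem measurable_dae_law {t : ℝ} (ht : 0 ≤ t) : Measurable (dae G.law t) := by
  rcases ht.eq_or_lt with rfl | ht
  · rw [dae_zero]; exact measurable_id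
  · have e : dae G.law t = fun x => x + t • -∑ k, G.resp (G.noisyCov t) k x •
        matAct (G.noisyCov t k)⁻¹ (x - G.mean k) := by
      ext1 x
      rw [G.dae_law ht, G.score_mixDensity (G.posDef_noisyCov ht.le)]
    have hr : ∀ k, Measurable (G.resp (G.noisyCov t) k) := fun k =>
      Measurable.div (by fun_prop) (G.continuous_mixDensity _).measurable
    rw [e]
    fun_prop

theorem posSemidef_two_mul_sub_noisyCov {R t : ℝ} {k : Fin K}
    (hR : (R • (1 : Matrix (Fin m) (Fin m) ℝ) - G.cov k).PosSemidef) (ht : t ≤ R) :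
    ((2 * R) • (1 : Matrix (Fin m) (Fin m) ℝ) - G.noisyCov t k).PosSemidef := by
  have h := hR.add (posSemidef_smul_one (m := m) (sub_nonneg.2 ht))
  convert h using 1
  rw [noisyCov]; module

/-- Where one responsibility is almost `1`, the autoencoder is almost affine. -/
theorem exists_norm_dae_sub_daeAffine_le (m K : ℕ) {R w r δ : ℝ} (hR : 0 < R) (hw : 0 < w)
    (hr : 0 < r) (hδ : 0 < δ) :
    ∃ ε : ℝ, 0 < ε ∧ ∀ (G : GaussianMixture m K) (t : ℝ),
      (∀ k, (R • (1 : Matrix (Fin m) (Fin m) ℝ) - G.cov k).PosSemidef) → 0 ≤ t → t ≤ R →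
      ∀ k x, w ≤ G.weight k → mahalanobisSq (G.mean k) (G.cov k) x ≤ r ^ 2 →
        1 - ε ≤ G.resp (G.noisyCov t) k x → ‖dae G.law t x - G.daeAffine t k x‖ ≤ δ := by
  set C : ℝ := (2 * R) ^ m * Real.exp (r ^ 2) * R ^ 2 * (m + 2).factorial / w ^ 2 with hC
  -- Half of δ pays for the defect 1 - γ_k; the other half is shared among the other components,
  -- fewer than K + 1 in number.
  obtain ⟨ε, hε, hε1, hεA, hεB⟩ := exists_pos_le_one_mul_le (Real.sqrt R * r) C
    (a := δ / 2) (b := (δ / (2 * (K + 1))) ^ (2 * m + 4)) (by positivity) (by positivity)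
  refine ⟨ε, hε, fun G t hcov ht htR k x hk hx hresp => ?_⟩
  rcases ht.eq_or_lt with rfl | ht0
  · simp [dae_zero, G.daeAffine_zero, hδ.le]
  have hN := G.posDef_noisyCov ht
  have hDk : mahalanobisSq (G.mean k) (G.noisyCov t k) x ≤ r ^ 2 := by
    refine (mahalanobisSq_anti (G.cov_posDef k) (hN k) ?_ _ _).trans hx
    simpa [noisyCov] using posSemidef_smul_one (m := m) ht
  have hlow : ∀ j, (G.noisyCov t j - t • (1 : Matrix (Fin m) (Fin m) ℝ)).PosSemidef := by
    intro j; simpa [noisyCov] using (G.cov_posDef j).posSemidef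
  have hnorm : ∀ j, (t * ‖matAct (G.noisyCov t j)⁻¹ (x - G.mean j)‖) ^ 2
      ≤ t * mahalanobisSq (G.mean j) (G.noisyCov t j) x := by
    intro j
    have := mul_le_mul_of_nonneg_left (mul_norm_sq_matAct_inv_le (hN j) (hlow j) (G.mean j) x) ht
    calc _ = t * (t * ‖matAct (G.noisyCov t j)⁻¹ (x - G.mean j)‖ ^ 2) := by ring
      _ ≤ _ := this
  have hterm : ∀ j ∈ Finset.univ.erase k, t * (G.resp (G.noisyCov t) j x *
      ‖matAct (G.noisyCov t j)⁻¹ (x - G.mean j)‖) ≤ δ / (2 * (K + 1)) := by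
    intro j hj
    have hγ := G.resp_le_of_ne hN (Finset.ne_of_mem_erase hj) hresp
    have hγ0 := G.resp_nonneg hN j x
    set γ := G.resp (G.noisyCov t) j x
    set D := mahalanobisSq (G.mean j) (G.noisyCov t j) x
    have hD : 0 ≤ D := (hN j).mahalanobisSq_nonneg _ _
    set a := t * ‖matAct (G.noisyCov t j)⁻¹ (x - G.mean j)‖ with ha
    -- The Σ_j have no lower bound, so Σ_j + tI ≥ tI is all there is for the determinant; this costs
    -- the singular factor (2R/t)^m.
    have hsq : γ ^ 2 ≤ (2 * R / t) ^ m * Real.exp (r ^ 2) * Real.exp (-D) / w ^ 2 := by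
      refine (G.resp_sq_le hN ht0 (by positivity : 0 < 2 * R) hw
        (pow_le_det ht (hN j).1 (hlow j)) (det_le_pow (hN k).posSemidef
          (G.posSemidef_two_mul_sub_noisyCov (hcov k) htR)) hk x).trans ?_
      have hj1 : G.weight j ^ 2 ≤ 1 := pow_le_one₀ (G.weight_nonneg j) (G.weight_le_one j)
      refine div_le_div_of_nonneg_right ?_ (by positivity)
      refine (mul_le_of_le_one_left (by positivity) hj1).trans ?_
      gcongr
    -- The exponent is chosen so that γ² gives the Gaussian decay, γ^(2m+2) gives ε, and the t^(m+2)
    -- coming from a^(2m+4) beats t^(-m); the remaining t² is at most R².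
    have hpow : (γ * a) ^ (2 * m + 4) ≤ (δ / (2 * (K + 1))) ^ (2 * m + 4) := by
      calc (γ * a) ^ (2 * m + 4) = γ ^ (2 * m + 2) * γ ^ 2 * (a ^ 2) ^ (m + 2) := by ring
        _ ≤ ε * ((2 * R / t) ^ m * Real.exp (r ^ 2) * Real.exp (-D) / w ^ 2) *
            (t * D) ^ (m + 2) := by
            have h1 : γ ^ (2 * m + 2) ≤ ε := by
              calc γ ^ (2 * m + 2) ≤ ε ^ (2 * m + 2) := by gcongr
                _ ≤ ε ^ 1 := pow_le_pow_of_le_one hε.le hε1 (by omega)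
                _ = ε := pow_one ε
            have h2 := hnorm j
            gcongr
        _ = ε * ((2 * R) ^ m * Real.exp (r ^ 2) * t ^ 2 * (D ^ (m + 2) * Real.exp (-D))
            / w ^ 2) := by
            rw [div_pow]; field_simp; ring
        _ ≤ ε * C := by
            rw [hC]
            have := pow_mul_exp_neg_le hD (m + 2)
            gcongr
        _ ≤ _ := hεB
    have h0 : 0 ≤ δ / (2 * ((K : ℝ) + 1)) := by positivity
    calc _ = γ * a := by rw [ha]; ring
      _ ≤ _ := le_of_pow_le_pow_left₀ (by omega) h0 hpow
  have hk1 : t * ‖matAct (G.noisyCov t k)⁻¹ (x - G.mean k)‖ ≤ Real.sqrt R * r := by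
    refine abs_le_of_sq_le_sq' ?_ (by positivity) |>.2
    rw [mul_pow (Real.sqrt R), Real.sq_sqrt hR.le]
    refine (hnorm k).trans ?_
    have := (hN k).mahalanobisSq_nonneg (G.mean k) x
    gcongr
  have e : dae G.law t x - G.daeAffine t k x = t • (score (G.mixDensity (G.noisyCov t)) x +
      matAct (G.noisyCov t k)⁻¹ (x - G.mean k)) := by
    rw [G.dae_law ht0, G.daeAffine_eq ht]; module
  rw [e, norm_smul, Real.norm_of_nonneg ht]
  refine (mul_le_mul_of_nonneg_left (G.norm_score_sub_le hN k x) ht).trans ?_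
  rw [mul_add, Finset.mul_sum]
  have hA : t * ((1 - G.resp (G.noisyCov t) k x) *
      ‖matAct (G.noisyCov t k)⁻¹ (x - G.mean k)‖) ≤ δ / 2 := by
    have h1 : 1 - G.resp (G.noisyCov t) k x ≤ ε := by linarith
    calc _ = (1 - G.resp (G.noisyCov t) k x) *
          (t * ‖matAct (G.noisyCov t k)⁻¹ (x - G.mean k)‖) := by ring
      _ ≤ ε * (Real.sqrt R * r) := by gcongr
      _ ≤ _ := hεA
  have hB := Finset.sum_le_card_nsmul _ _ _ hterm
  have hcard : ((Finset.univ.erase k).card : ℝ) ≤ K + 1 := by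
    have : (Finset.univ.erase k).card ≤ K := by
      simp
    have : ((Finset.univ.erase k).card : ℝ) ≤ K := by exact_mod_cast this
    linarith
  have hB2 : (Finset.univ.erase k).card • (δ / (2 * ((K : ℝ) + 1))) ≤ δ / 2 := by
    rw [nsmul_eq_mul]
    calc _ ≤ ((K : ℝ) + 1) * (δ / (2 * ((K : ℝ) + 1))) := by gcongr
      _ = δ / 2 := by field_simp
  linarith

/-! ### Lévy–Prokhorov estimate for the ordinary autoencoder. -/

theorem map_daeAffine {t : ℝ} (ht : 0 ≤ t) (k : Fin K) :
    (multivariateGaussian (G.mean k) (G.cov k)).map (G.daeAffine t k)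
      = multivariateGaussian (G.mean k) (G.daeCov t k) := by
  have hS := G.cov_posDef k
  have hA := posDef_one_add_smul_inv hS ht
  have h := multivariateGaussian_map_affine (G.mean k) hS.posSemidef hA.inv.1
  refine h.trans ?_
  congr 1
  have hcomm : Commute (1 + t • (G.cov k)⁻¹)⁻¹ (G.cov k) := by
    have h1 : Commute (1 + t • (G.cov k)⁻¹) (G.cov k) := by
      refine (Commute.one_left _).add_left (Commute.smul_left ?_ _)
      rw [Commute, SemiconjBy, Matrix.nonsing_inv_mul _ hS.det_isUnit,
        Matrix.mul_nonsing_inv _ hS.det_isUnit]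
    rw [Commute, SemiconjBy] at h1 ⊢
    have h2 := hA.det_isUnit
    calc _ = (1 + t • (G.cov k)⁻¹)⁻¹ * (G.cov k * (1 + t • (G.cov k)⁻¹)) *
          (1 + t • (G.cov k)⁻¹)⁻¹ := by
            rw [mul_assoc, mul_assoc, Matrix.mul_nonsing_inv _ h2, mul_one]
      _ = _ := by rw [← h1, ← mul_assoc, Matrix.nonsing_inv_mul _ h2, one_mul]
  rw [daeCov, hcomm.eq, mul_assoc, sq]

/-- A coupling bound for the Lévy–Prokhorov distance of componentwise pushforwards. -/
theorem levyProkhorovEDist_map_le {P : Fin K → Measure (Ground m)} {f : Ground m → Ground m}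
    {g : Fin K → Ground m → Ground m} (hf : Measurable f) (hg : ∀ k, Measurable (g k))
    {c : Fin K → ℝ≥0∞} {δ η : ℝ} (hδ : 0 < δ) (hη : η < δ)
    (h : ∑ k, c k * P k {x | η < ‖f x - g k x‖} ≤ ENNReal.ofReal δ) :
    levyProkhorovEDist ((∑ k, c k • P k).map f) (∑ k, c k • (P k).map (g k))
      ≤ ENNReal.ofReal δ := by
  -- Formulated for two families so that exchanging them gives both inequalities of the
  -- Lévy–Prokhorov distance; η < δ is needed because thickenings are open.
  have key : ∀ (u v : Fin K → Ground m → Ground m),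
      (∀ k x, ‖u k x - v k x‖ = ‖f x - g k x‖) → ∀ B : Set (Ground m),
      ∑ k, c k * P k (u k ⁻¹' B) ≤
        ∑ k, c k * P k (v k ⁻¹' Metric.thickening δ B) + ENNReal.ofReal δ := by
    intro u v huv B
    refine le_trans ?_ (add_le_add le_rfl h)
    rw [← Finset.sum_add_distrib]
    refine Finset.sum_le_sum fun k _ => ?_
    rw [← mul_add]
    refine mul_le_mul_right ((measure_mono ?_).trans (measure_union_le _ _)) _
    intro x hx
    by_cases hbad : η < ‖f x - g k x‖
    · exact mem_union_right _ hbad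
    · refine mem_union_left _ (mem_preimage.2 (Metric.mem_thickening_iff.2 ⟨u k x, hx, ?_⟩))
      rw [dist_comm, dist_eq_norm, huv]
      exact (not_lt.1 hbad).trans_lt hη
  refine sInf_le fun B hB => ?_
  rw [ENNReal.toReal_ofReal hδ.le]
  have hf' : ∀ B, MeasurableSet B → (∑ k, c k • P k).map f B = ∑ k, c k * P k (f ⁻¹' B) := by
    intro B hB
    rw [Measure.map_apply hf hB, Measure.finsetSum_apply]; rfl
  have hg' : ∀ B, MeasurableSet B →
      (∑ k, c k • (P k).map (g k)) B = ∑ k, c k * P k (g k ⁻¹' B) := by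
    intro B hB
    rw [Measure.finsetSum_apply]
    exact Finset.sum_congr rfl fun k _ => by
      rw [Measure.smul_apply, Measure.map_apply (hg k) hB, smul_eq_mul]
  have hT : MeasurableSet (Metric.thickening δ B) := Metric.isOpen_thickening.measurableSet
  rw [hf' B hB, hg' B hB, hf' _ hT, hg' _ hT]
  exact ⟨key (fun _ => f) g (fun _ _ => rfl) B,
    key g (fun _ => f) (fun _ _ => norm_sub_rev _ _) B⟩

theorem WellSeparated.mono {G : GaussianMixture m K} {S : Fin K → Matrix (Fin m) (Fin m) ℝ}
    {Ω : Fin K → Set (Ground m)} {ε ε' : ℝ} (h : G.WellSeparated S Ω ε) (hε : ε ≤ ε') :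
    G.WellSeparated S Ω ε' := fun k =>
  ⟨(h k).1, (ENNReal.ofReal_le_ofReal (by linarith)).trans (h k).2.1,
    fun x hx => le_trans (by linarith) ((h k).2.2 x hx)⟩

theorem exists_levyProkhorovEDist_dae_le (m K : ℕ) {R δ : ℝ} (hR : 0 < R) (hδ : 0 < δ) :
    ∃ ε : ℝ, 0 < ε ∧ ∀ (G : GaussianMixture m K) (t : ℝ) (Ω : Fin K → Set (Ground m)),
      (∀ k, (R • (1 : Matrix (Fin m) (Fin m) ℝ) - G.cov k).PosSemidef) → 0 ≤ t → t ≤ R →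
      G.WellSeparated (G.noisyCov t) Ω ε →
      levyProkhorovEDist (G.law.map (dae G.law t))
        (gaussianSum G.weight G.mean (G.daeCov t)) ≤ ENNReal.ofReal δ := by
  obtain ⟨r, hr, htail⟩ := exists_stdGaussian_norm_gt_le m (δ := δ / 3) (by positivity)
  -- Components lighter than `w` are given up: together they weigh at most δ/3. For the others, δ/3
  -- goes to the Gaussian tail and δ/3 to the mass missed by Ω_k.
  set w : ℝ := δ / (3 * (K + 1)) with hw_def
  have hw : 0 < w := by positivity
  obtain ⟨ε, hε, hpt⟩ := exists_norm_dae_sub_daeAffine_le m K hR hw hr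
    (δ := δ / 2) (by positivity)
  refine ⟨min ε (δ / 3), by positivity, fun G t Ω hcov ht htR hsep => ?_⟩
  have hmd := G.measurable_dae_law ht
  have hma : ∀ k, Measurable (G.daeAffine t k) := by
    intro k; unfold daeAffine; fun_prop
  have e : gaussianSum G.weight G.mean (G.daeCov t) = ∑ k, ENNReal.ofReal (G.weight k) •
      (multivariateGaussian (G.mean k) (G.cov k)).map (G.daeAffine t k) := by
    simp only [gaussianSum, G.map_daeAffine ht]
  rw [e]
  refine levyProkhorovEDist_map_le hmd hma hδ (half_lt_self hδ) ?_
  have hterm : ∀ k, ENNReal.ofReal (G.weight k) * multivariateGaussian (G.mean k) (G.cov k)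
      {x | δ / 2 < ‖dae G.law t x - G.daeAffine t k x‖}
      ≤ ENNReal.ofReal (G.weight k * (2 * δ / 3) + w) := by
    intro k
    have hk0 := G.weight_nonneg k
    set N := multivariateGaussian (G.mean k) (G.cov k)
    set A := {x | δ / 2 < ‖dae G.law t x - G.daeAffine t k x‖} with hA_def
    have hA : MeasurableSet A := by
      have := hma k
      exact measurableSet_lt measurable_const (hmd.sub this).norm
    rcases lt_or_ge (G.weight k) w with hlt | hge
    · calc _ ≤ ENNReal.ofReal (G.weight k) * 1 := by gcongr; exact prob_le_one
        _ ≤ _ := by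
          rw [mul_one]
          refine ENNReal.ofReal_le_ofReal ?_
          have : 0 ≤ G.weight k * (2 * δ / 3) := by positivity
          linarith
    · set Q := {x | r ^ 2 < mahalanobisSq (G.mean k) (G.cov k) x} with hQ_def
      have hQ : MeasurableSet Q := measurableSet_lt (by fun_prop) (by fun_prop)
      have hNQ : N Q ≤ ENNReal.ofReal (δ / 3) := by
        rw [multivariateGaussian_mahalanobisSq_gt _ (G.cov_posDef k) hr.le]; exact htail
      -- Ω_k need not be measurable, so the complement is taken of the measurable set A \ Q that it
      -- avoids.
      have hsub : Ω k ⊆ (A \ Q)ᶜ := by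
        intro x hx hxA
        refine absurd hxA.1 (not_lt.2 (hpt G t hcov ht htR k x hge (not_lt.1 hxA.2) ?_))
        have := (hsep k).2.2 x hx
        have h2 := min_le_left ε (δ / 3)
        linarith
      have hNA : N (A \ Q) ≤ ENNReal.ofReal (δ / 3) := by
        have h1 := (hsep k).2.1.trans (measure_mono hsub)
        rw [prob_compl_eq_one_sub (hA.diff hQ)] at h1
        have h2 : N (A \ Q) + ENNReal.ofReal (1 - min ε (δ / 3)) ≤ 1 := by
          calc _ ≤ N (A \ Q) + (1 - N (A \ Q)) := by gcongr
            _ = 1 := add_tsub_cancel_of_le prob_le_one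
        have h3 : (1 : ℝ≥0∞) ≤ ENNReal.ofReal (1 - min ε (δ / 3)) + ENNReal.ofReal (δ / 3) := by
          rw [← ENNReal.ofReal_one]
          refine le_trans (ENNReal.ofReal_le_ofReal ?_) ENNReal.ofReal_add_le
          have := min_le_right ε (δ / 3)
          linarith
        rw [add_comm] at h2
        exact (ENNReal.add_le_add_iff_left ENNReal.ofReal_ne_top).1 (h2.trans h3)
      have hN : N A ≤ ENNReal.ofReal (2 * δ / 3) := by
        calc N A ≤ N (Q ∪ (A \ Q)) := measure_mono (by intro x hx; simp [hx])
          _ ≤ N Q + N (A \ Q) := measure_union_le _ _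
          _ ≤ ENNReal.ofReal (δ / 3) + ENNReal.ofReal (δ / 3) := add_le_add hNQ hNA
          _ = _ := by rw [← ENNReal.ofReal_add (by positivity) (by positivity)]; congr 1; ring
      calc _ ≤ ENNReal.ofReal (G.weight k) * ENNReal.ofReal (2 * δ / 3) := by gcongr
        _ = ENNReal.ofReal (G.weight k * (2 * δ / 3)) := (ENNReal.ofReal_mul hk0).symm
        _ ≤ _ := ENNReal.ofReal_le_ofReal (by linarith)
  refine (Finset.sum_le_sum fun k _ => hterm k).trans ?_
  rw [← ENNReal.ofReal_sum_of_nonneg fun k _ => by have := G.weight_nonneg k; positivity]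
  refine ENNReal.ofReal_le_ofReal ?_
  rw [Finset.sum_add_distrib, ← Finset.sum_mul, G.weight_sum]
  have : ((K : ℝ) * w) ≤ δ / 3 := by
    rw [hw_def, ← mul_div_assoc, div_le_div_iff₀ (by positivity) (by positivity)]
    nlinarith
  simp only [Finset.sum_const, Finset.card_univ, Fintype.card_fin, nsmul_eq_mul]
  linarith

end GaussianMixture

end Ratio

/-! ### The backward heat equation -/

section BackwardHeat

open scoped ContDiff

variable {m : ℕ}

theorem smul_score {ρ : Ground m → ℝ} {x : Ground m} (hpos : 0 < ρ x)
    (hd : DifferentiableAt ℝ ρ x) : ρ x • score ρ x = gradient ρ x := by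
  have h := (hd.hasFDerivAt.log hpos.ne').hasGradientAt.gradient
  rw [score, h, gradient, map_smul, smul_smul, mul_inv_cancel₀ hpos.ne', one_smul]

theorem fderiv_apply_eq_inner_score {ρ : Ground m → ℝ} {x : Ground m} (hpos : 0 < ρ x)
    (hd : DifferentiableAt ℝ ρ x) (v : Ground m) :
    fderiv ℝ ρ x v = ρ x * inner ℝ (score ρ x) v := by
  rw [← real_inner_smul_left, smul_score hpos hd, gradient, InnerProductSpace.toDual_symm_apply]

/-- The sum of the second partial derivatives. -/
def sumSecondDeriv (f : Ground m → ℂ) (x : Ground m) : ℂ :=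
  ∑ i, fderiv ℝ (fun y => fderiv ℝ f y (EuclideanSpace.basisFun (Fin m) ℝ i)) x
    (EuclideanSpace.basisFun (Fin m) ℝ i)

theorem contDiff_fderiv_apply {F : Type*} [NormedAddCommGroup F] [NormedSpace ℝ F]
    {f : Ground m → F} (hf : ContDiff ℝ ∞ f) (v : Ground m) :
    ContDiff ℝ ∞ fun y => fderiv ℝ f y v :=
  (hf.fderiv_right (m := ∞) (by simp)).clm_apply contDiff_const

theorem hasCompactSupport_fderiv_apply {F : Type*} [NormedAddCommGroup F] [NormedSpace ℝ F]
    {f : Ground m → F} (hf : HasCompactSupport f) (v : Ground m) :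
    HasCompactSupport fun y => fderiv ℝ f y v :=
  (hf.fderiv (𝕜 := ℝ)).comp_left (g := fun L : Ground m →L[ℝ] F => L v) (by simp)

/-- Since ρ ∇ log ρ = ∇ρ, this is one integration by parts per coordinate. Only `f` is
differentiated twice, and its compact support makes every integrand integrable: the weak form of
-div(p ∇ log p) = -Δp. -/
theorem integral_smul_fderiv_score {ρ : Ground m → ℝ} (hpos : ∀ x, 0 < ρ x)
    (hd : Differentiable ℝ ρ) (hc : Continuous (score ρ)) {f : Ground m → ℂ}
    (hf : ContDiff ℝ ∞ f) (hsupp : HasCompactSupport f) :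
    ∫ x, ρ x • fderiv ℝ f x (score ρ x) = -∫ x, ρ x • sumSecondDeriv f x := by
  set b := EuclideanSpace.basisFun (Fin m) ℝ with hb
  have hρc : Continuous ρ := hd.continuous
  have hρ' : ∀ i, Continuous fun x => fderiv ℝ ρ x (b i) := by
    intro i
    simp_rw [fderiv_apply_eq_inner_score (hpos _) (hd _)]
    fun_prop
  have hf1 : ∀ i, ContDiff ℝ ∞ fun y => fderiv ℝ f y (b i) :=
    fun i => contDiff_fderiv_apply hf _
  have hs1 : ∀ i, HasCompactSupport fun y => fderiv ℝ f y (b i) :=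
    fun i => hasCompactSupport_fderiv_apply hsupp _
  have hf2 : ∀ i, ContDiff ℝ ∞ fun x => fderiv ℝ (fun y => fderiv ℝ f y (b i)) x (b i) :=
    fun i => contDiff_fderiv_apply (hf1 i) _
  have hs2 : ∀ i, HasCompactSupport fun x => fderiv ℝ (fun y => fderiv ℝ f y (b i)) x (b i) :=
    fun i => hasCompactSupport_fderiv_apply (hs1 i) _
  have hint1 : ∀ i, Integrable fun x => fderiv ℝ ρ x (b i) • fderiv ℝ f x (b i) := fun i =>
    ((hρ' i).smul (hf1 i).continuous).integrable_of_hasCompactSupport (hs1 i).smul_left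
  have hint2 : ∀ i, Integrable fun x => ρ x • fderiv ℝ (fun y => fderiv ℝ f y (b i)) x (b i) :=
    fun i => (hρc.smul (hf2 i).continuous).integrable_of_hasCompactSupport (hs2 i).smul_left
  have hint3 : ∀ i, Integrable fun x => ρ x • fderiv ℝ f x (b i) := fun i =>
    (hρc.smul (hf1 i).continuous).integrable_of_hasCompactSupport (hs1 i).smul_left
  have e : ∀ x, ρ x • fderiv ℝ f x (score ρ x)
      = ∑ i, fderiv ℝ ρ x (b i) • fderiv ℝ f x (b i) := by
    intro x
    conv_lhs => rw [← b.sum_repr' (score ρ x)]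
    rw [map_sum, Finset.smul_sum]
    refine Finset.sum_congr rfl fun i _ => ?_
    rw [map_smul, smul_smul, fderiv_apply_eq_inner_score (hpos x) (hd x), real_inner_comm]
  simp_rw [e, sumSecondDeriv, Finset.smul_sum]
  rw [integral_finsetSum _ fun i _ => hint1 i, integral_finsetSum _ fun i _ => hint2 i,
    ← Finset.sum_neg_distrib]
  refine Finset.sum_congr rfl fun i _ => ?_
  rw [integral_smul_fderiv_eq_neg_fderiv_smul_of_integrable (hint1 i) (hint2 i) (hint3 i)
    (fun x _ => hd x) (fun x _ => ((hf1 i).differentiable (by simp)) x), neg_neg]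

/-- Transport of a test function along a flow with locally bounded velocity. -/
theorem hasDerivAt_integral_comp_flow {P : Measure (Ground m)} [IsFiniteMeasure P] {T : ℝ}
    {φ : ℝ → Ground m → Ground m} {V : ℝ → Ground m → Ground m}
    (hφ : ∀ t ∈ Ico 0 T, Measurable (φ t))
    (hV : ContinuousOn (fun z : ℝ × Ground m => V z.1 z.2) (Ico 0 T ×ˢ univ))
    (hode : ∀ x, ∀ t ∈ Ico 0 T, HasDerivWithinAt (fun s => φ s x) (V t (φ t x)) (Ico 0 T) t)
    {f : Ground m → ℂ} (hf : ContDiff ℝ ∞ f) (hsupp : HasCompactSupport f)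
    {t : ℝ} (ht : t ∈ Ioo 0 T) :
    HasDerivAt (fun s => ∫ x, f (φ s x) ∂P)
      (∫ x, fderiv ℝ f (φ t x) (V t (φ t x)) ∂P) t := by
  obtain ⟨a, ha0, hat⟩ := exists_between ht.1
  obtain ⟨b, htb, hbT⟩ := exists_between ht.2
  have hsub : Icc a b ⊆ Ico 0 T := fun s hs => ⟨ha0.le.trans hs.1, hs.2.trans_lt hbT⟩
  have hf' : Continuous (fderiv ℝ f) := hf.continuous_fderiv (by simp)
  have hgc : ContinuousOn (fun z : ℝ × Ground m => fderiv ℝ f z.2 (V z.1 z.2))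
      (Ico 0 T ×ˢ univ) := (hf'.comp continuous_snd).continuousOn.clm_apply hV
  -- The velocity may be unbounded, but the derivative of `f` vanishes off a compact set, so a bound
  -- on that set over [a, b] dominates everywhere.
  obtain ⟨C, hC⟩ := (isCompact_Icc.prod hsupp).exists_bound_of_continuousOn
    (hgc.mono (prod_mono hsub (subset_univ _)))
  have hbound : ∀ s ∈ Icc a b, ∀ y, ‖fderiv ℝ f y (V s y)‖ ≤ max C 0 := by
    intro s hs y
    by_cases hy : y ∈ tsupport f
    · exact (hC (s, y) ⟨hs, hy⟩).trans (le_max_left _ _)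
    · have : fderiv ℝ f y = 0 := by
        by_contra h
        exact hy (support_fderiv_subset ℝ h)
      simp [this]
  have hVc : ∀ s ∈ Ico 0 T, Continuous fun y => fderiv ℝ f y (V s y) := by
    intro s hs
    exact continuousOn_univ.1 (hgc.comp (f := fun y : Ground m => (s, y)) (by fun_prop)
      fun y _ => ⟨hs, mem_univ _⟩)
  have hfm := hf.continuous.measurable
  obtain ⟨Cf, hCf⟩ := hsupp.exists_bound_of_continuous hf.continuous
  have htI : t ∈ Ico 0 T := ⟨ht.1.le, ht.2⟩
  refine (hasDerivAt_integral_of_dominated_loc_of_deriv_le (μ := P) (s := Icc a b)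
    (F := fun s x => f (φ s x)) (F' := fun s x => fderiv ℝ f (φ s x) (V s (φ s x)))
    (bound := fun _ => max C 0) (Icc_mem_nhds hat htb) ?_ ?_ ?_ ?_ (integrable_const _) ?_).2
  · filter_upwards [Icc_mem_nhds hat htb] with s hs
    exact (hfm.comp (hφ s (hsub hs))).aestronglyMeasurable
  · exact Integrable.of_bound (hfm.comp (hφ t htI)).aestronglyMeasurable Cf
      (Filter.Eventually.of_forall fun x => hCf _)
  · exact ((hVc t htI).measurable.comp (hφ t htI)).aestronglyMeasurable
  · exact Filter.Eventually.of_forall fun x s hs => hbound s hs _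
  · refine Filter.Eventually.of_forall fun x s hs => ?_
    have h1 := (hode x s (hsub hs)).hasDerivAt
      (Ico_mem_nhds (ha0.trans_le hs.1) (hs.2.trans_lt hbT))
    exact (hf.differentiable (by simp) (φ s x)).hasFDerivAt.comp_hasDerivAt s h1

/-- The plane wave `x ↦ exp (i ⟨x, ξ⟩)`. -/
def planeWave (ξ x : Ground m) : ℂ := Complex.exp (inner ℝ x ξ * Complex.I)

theorem norm_planeWave (ξ x : Ground m) : ‖planeWave ξ x‖ = 1 :=
  Complex.norm_exp_ofReal_mul_I _

theorem contDiff_planeWave (ξ : Ground m) : ContDiff ℝ ∞ (planeWave ξ) := by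
  unfold planeWave
  have h : ContDiff ℝ ∞ fun x : Ground m => ((inner ℝ x ξ : ℝ) : ℂ) :=
    Complex.ofRealCLM.contDiff.comp (contDiff_id.inner ℝ contDiff_const)
  exact (h.mul contDiff_const).cexp

theorem fderiv_smul_planeWave (ξ : Ground m) {g : Ground m → ℝ} {x : Ground m}
    (hg : DifferentiableAt ℝ g x) (v : Ground m) :
    fderiv ℝ (fun y => g y • planeWave ξ y) x v
      = fderiv ℝ g x v • planeWave ξ x
        + (inner ℝ v ξ * Complex.I) * (g x • planeWave ξ x) := by
  have h1 : HasFDerivAt (fun y : Ground m => ((inner ℝ y ξ : ℝ) : ℂ) * Complex.I)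
      ((Complex.ofRealCLM.comp (innerSL ℝ ξ)).smulRight Complex.I) x := by
    have : (fun y : Ground m => ((inner ℝ y ξ : ℝ) : ℂ) * Complex.I)
        = ((Complex.ofRealCLM.comp (innerSL ℝ ξ)).smulRight Complex.I) := by
      ext y; simp [real_inner_comm]
    rw [this]
    exact ContinuousLinearMap.hasFDerivAt _
  have h2 := hg.hasFDerivAt.smul h1.cexp
  have h3 : HasFDerivAt (fun y => g y • planeWave ξ y) _ x := h2
  rw [h3.fderiv]
  simp [planeWave, real_inner_comm]
  ring

theorem fderiv_fderiv_smul_planeWave (ξ : Ground m) {g : Ground m → ℝ} (hg : ContDiff ℝ ∞ g)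
    (v x : Ground m) :
    fderiv ℝ (fun z => fderiv ℝ (fun y => g y • planeWave ξ y) z v) x v
      = (fderiv ℝ (fun z => fderiv ℝ g z v) x v : ℂ) * planeWave ξ x
        + 2 * (inner ℝ v ξ * Complex.I) * (fderiv ℝ g x v * planeWave ξ x)
        - (inner ℝ v ξ : ℂ) ^ 2 * (g x • planeWave ξ x) := by
  have hgd := hg.differentiable (by simp)
  have hgd' := (contDiff_fderiv_apply hg v).differentiable (by simp)
  have e : (fun z => fderiv ℝ (fun y => g y • planeWave ξ y) z v)
      = fun z => fderiv ℝ g z v • planeWave ξ z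
        + (inner ℝ v ξ * Complex.I) * (g z • planeWave ξ z) :=
    funext fun z => fderiv_smul_planeWave ξ (hgd z) v
  have hpw := (contDiff_planeWave ξ).differentiable (by simp)
  rw [e, fderiv_fun_add ((hgd' x).fun_smul (hpw x)) (((hgd x).fun_smul (hpw x)).const_mul _),
    fderiv_const_mul ((hgd x).fun_smul (hpw x))]
  rw [add_apply, smul_apply, fderiv_smul_planeWave ξ (hgd' x), fderiv_smul_planeWave ξ (hgd x)]
  simp only [Complex.real_smul, smul_eq_mul]
  linear_combination (inner ℝ v ξ : ℂ) ^ 2 * (g x * planeWave ξ x) * Complex.I_sq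

/-! ### Smooth cutoffs and truncated plane waves. -/

variable (m) in
/-- A smooth cutoff function equal to `1` on the ball of radius `n + 1`. -/
def cutoff (n : ℕ) (x : Ground m) : ℝ :=
  (⟨1, 2, one_pos, one_lt_two⟩ : ContDiffBump (0 : Ground m)) (((n : ℝ) + 1)⁻¹ • x)

theorem contDiff_cutoff (n : ℕ) : ContDiff ℝ ∞ (cutoff m n) :=
  (ContDiffBump.contDiff _).comp (contDiff_const_smul _)

theorem hasCompactSupport_cutoff (n : ℕ) : HasCompactSupport (cutoff m n) :=
  HasCompactSupport.comp_smul (ContDiffBump.hasCompactSupport _) (by positivity)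

theorem abs_cutoff_le_one (n : ℕ) (x : Ground m) : |cutoff m n x| ≤ 1 := by
  unfold cutoff
  rw [abs_of_nonneg (ContDiffBump.nonneg _)]
  exact ContDiffBump.le_one _

theorem tendsto_cutoff (x : Ground m) :
    Filter.Tendsto (fun n => cutoff m n x) Filter.atTop (𝓝 1) := by
  obtain ⟨N, hN⟩ := exists_nat_ge ‖x‖
  refine tendsto_const_nhds.congr' ?_
  filter_upwards [Filter.eventually_ge_atTop N] with n hn
  refine (ContDiffBump.one_of_mem_closedBall _ ?_).symm
  have h1 : (N : ℝ) ≤ n := by exact_mod_cast hn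
  rw [mem_closedBall_zero_iff, norm_smul, Real.norm_of_nonneg (by positivity), inv_mul_le_iff₀
    (by positivity)]
  linarith

theorem fderiv_comp_const_smul {g : Ground m → ℝ} (hg : Differentiable ℝ g) (c : ℝ)
    (x v : Ground m) : fderiv ℝ (fun y => g (c • y)) x v = c * fderiv ℝ g (c • x) v := by
  have h1 : HasFDerivAt (fun y : Ground m => c • y) (c • ContinuousLinearMap.id ℝ (Ground m)) x :=
    (hasFDerivAt_id x).const_smul c
  have h := (hg (c • x)).hasFDerivAt.comp x h1
  have h' : HasFDerivAt (fun y => g (c • y)) _ x := h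
  rw [h'.fderiv]; simp

/-- Each derivative of the rescaled bump brings a factor 1/(n+1); for the second derivative one of
the two factors is simply bounded by 1. -/
theorem exists_fderiv_cutoff_le (v : Ground m) : ∃ C, 0 ≤ C ∧ ∀ n x,
    |fderiv ℝ (cutoff m n) x v| ≤ C / (n + 1) ∧
    |fderiv ℝ (fun y => fderiv ℝ (cutoff m n) y v) x v| ≤ C / (n + 1) := by
  set χ : ContDiffBump (0 : Ground m) := ⟨1, 2, one_pos, one_lt_two⟩
  have hχ : ContDiff ℝ ∞ χ := χ.contDiff
  have h1 := contDiff_fderiv_apply hχ v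
  have h2 := contDiff_fderiv_apply h1 v
  have s1 := hasCompactSupport_fderiv_apply χ.hasCompactSupport v
  have s2 := hasCompactSupport_fderiv_apply s1 v
  obtain ⟨C1, hC1⟩ := s1.exists_bound_of_continuous h1.continuous
  obtain ⟨C2, hC2⟩ := s2.exists_bound_of_continuous h2.continuous
  have e1 : ∀ n, (fun x => fderiv ℝ (cutoff m n) x v) =
      fun x => ((n : ℝ) + 1)⁻¹ * fderiv ℝ χ (((n : ℝ) + 1)⁻¹ • x) v := fun n =>
    funext fun x => fderiv_comp_const_smul (hχ.differentiable (by simp)) _ x v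
  refine ⟨max C1 C2 ⊔ 0, le_max_right _ _, fun n x => ⟨?_, ?_⟩⟩
  · rw [congrFun (e1 n) x, abs_mul, abs_of_pos (by positivity : 0 < ((n : ℝ) + 1)⁻¹),
      inv_mul_eq_div]
    gcongr
    exact (hC1 _).trans ((le_max_left _ _).trans (le_max_left _ _))
  · have hd := h1.differentiable (by simp)
    have hd' : DifferentiableAt ℝ (fun y => fderiv ℝ χ (((n : ℝ) + 1)⁻¹ • y) v) x :=
      (hd.comp (g := fun y => fderiv ℝ χ y v) (f := fun y => ((n : ℝ) + 1)⁻¹ • y) (by fun_prop)) x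
    rw [e1 n, fderiv_const_mul hd', smul_apply, fderiv_comp_const_smul hd, smul_eq_mul, abs_mul,
      abs_mul, abs_of_pos (by positivity : 0 < ((n : ℝ) + 1)⁻¹)]
    have h3 := (hC2 (((n : ℝ) + 1)⁻¹ • x)).trans ((le_max_right C1 C2).trans (le_max_left _ 0))
    have h4 : ((n : ℝ) + 1)⁻¹ ≤ 1 := inv_le_one_of_one_le₀ (by linarith [n.cast_nonneg (α := ℝ)])
    rw [Real.norm_eq_abs] at h3
    calc _ ≤ ((n : ℝ) + 1)⁻¹ * (1 * (max C1 C2 ⊔ 0)) := by gcongr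
      _ = _ := by rw [one_mul, inv_mul_eq_div]

/-- The truncated plane wave is an approximate eigenfunction of the Laplacian. -/
theorem exists_norm_sumSecondDeriv_le (ξ : Ground m) : ∃ C, 0 ≤ C ∧ ∀ n x,
    ‖sumSecondDeriv (fun y => cutoff m n y • planeWave ξ y) x
      + ‖ξ‖ ^ 2 * (cutoff m n x • planeWave ξ x)‖ ≤ C / (n + 1) := by
  set b := EuclideanSpace.basisFun (Fin m) ℝ with hb
  choose C hC0 hC using fun i => exists_fderiv_cutoff_le (b i)
  refine ⟨∑ i, (C i + 2 * |inner ℝ (b i) ξ| * C i),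
    Finset.sum_nonneg fun i _ => by have := hC0 i; positivity, fun n x => ?_⟩
  -- By Parseval the term |ξ|² cancels coordinatewise, leaving only terms with a derivative of the
  -- cutoff.
  have hξ : (‖ξ‖ : ℂ) ^ 2 = ∑ i, (inner ℝ (b i) ξ : ℂ) ^ 2 := by
    have := b.sum_sq_inner_right ξ
    exact_mod_cast this.symm
  rw [sumSecondDeriv, hξ, Finset.sum_mul, ← Finset.sum_add_distrib, Finset.sum_div]
  refine (norm_sum_le _ _).trans (Finset.sum_le_sum fun i _ => ?_)
  rw [fderiv_fderiv_smul_planeWave ξ (contDiff_cutoff n), sub_add_cancel]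
  refine (norm_add_le _ _).trans ?_
  rw [norm_mul, norm_mul, norm_mul, norm_mul, norm_mul, norm_planeWave, Complex.norm_I]
  simp only [Complex.norm_real, Complex.norm_ofNat, mul_one, Real.norm_eq_abs]
  obtain ⟨h1, h2⟩ := hC i n x
  rw [add_div, mul_div_assoc]
  gcongr

/-- Along a continuous denoising autoencoder the characteristic function solves the backward heat
equation. -/
theorem charFun_map_of_isContinuousDAE {P : Measure (Ground m)} [IsProbabilityMeasure P] {T : ℝ}
    {φ : ℝ → Ground m → Ground m} (h : IsContinuousDAE P T φ) {t : ℝ} (ht : t ∈ Ico 0 T)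
    (ξ : Ground m) :
    Complex.exp (-(t * ‖ξ‖ ^ 2 : ℝ)) * charFun (P.map (φ t)) ξ = charFun P ξ := by
  obtain ⟨h0, hφ, ρ, hρ, hV, hode⟩ := h
  set f : ℕ → Ground m → ℂ := fun n y => cutoff m n y • planeWave ξ y with hf_def
  have hfs : ∀ n, ContDiff ℝ ∞ (f n) := fun n => (contDiff_cutoff n).smul (contDiff_planeWave ξ)
  have hfc : ∀ n, HasCompactSupport (f n) := fun n => (hasCompactSupport_cutoff n).smul_right
  have hf1 : ∀ n y, ‖f n y‖ ≤ 1 := fun n y => by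
    rw [hf_def, norm_smul, norm_planeWave, mul_one]; exact abs_cutoff_le_one n y
  obtain ⟨C, hC0, hC⟩ := exists_norm_sumSecondDeriv_le ξ
  set F : ℕ → ℝ → ℂ := fun n s => Complex.exp (-(s * ‖ξ‖ ^ 2 : ℝ)) * ∫ x, f n (φ s x) ∂P
    with hF
  have hscont : ∀ s ∈ Ico 0 T, Continuous (score (ρ s)) := fun s hs =>
    continuousOn_univ.1 (hV.comp (f := fun y : Ground m => (s, y)) (by fun_prop)
      fun y _ => ⟨hs, mem_univ _⟩)
  have hpush : ∀ s ∈ Ico 0 T, ∀ g : Ground m → ℂ, Continuous g →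
      ∫ x, g (φ s x) ∂P = ∫ y, ρ s y • g y := by
    intro s hs g hg
    obtain ⟨hpos, hd, hmap⟩ := hρ s hs
    rw [← integral_map (hφ s hs).aemeasurable hg.aestronglyMeasurable, hmap,
      integral_withDensity_eq_integral_toReal_smul (hd.continuous.measurable.ennreal_ofReal)
        (by simp)]
    refine integral_congr_ae (Filter.Eventually.of_forall fun y => ?_)
    simp only [ENNReal.toReal_ofReal (hpos y).le]
  have hρint : ∀ s ∈ Ico 0 T, Integrable (ρ s) ∧ ∫ y, ρ s y = 1 := by
    intro s hs
    obtain ⟨hpos, hd, hmap⟩ := hρ s hs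
    have hprob := Measure.isProbabilityMeasure_map (μ := P) (hφ s hs).aemeasurable
    have h1 : ∫⁻ y, ENNReal.ofReal (ρ s y) = 1 := by
      rw [← setLIntegral_univ, ← withDensity_apply _ MeasurableSet.univ, ← hmap, measure_univ]
    have hi : Integrable (ρ s) := by
      refine ⟨hd.continuous.aestronglyMeasurable, ?_⟩
      rw [hasFiniteIntegral_iff_ofReal (Filter.Eventually.of_forall fun y => (hpos y).le), h1]
      exact ENNReal.one_lt_top
    refine ⟨hi, ?_⟩
    rw [integral_eq_lintegral_of_nonneg_ae (Filter.Eventually.of_forall fun y => (hpos y).le)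
      hi.1, h1, ENNReal.toReal_one]
  -- The exponential is the integrating factor: the derivative equals -exp(-s|ξ|²) ∫ ρ (Δf_n + |ξ|²
  -- f_n), which is O(1/n) because ρ has mass one.
  have hderiv : ∀ n, ∀ s ∈ Ioo 0 T, ∃ F' : ℂ, HasDerivAt (F n) F' s ∧ ‖F'‖ ≤ C / (n + 1) := by
    intro n s hs
    have hsI : s ∈ Ico 0 T := ⟨hs.1.le, hs.2⟩
    obtain ⟨hpos, hd, hmap⟩ := hρ s hsI
    have hD := hasDerivAt_integral_comp_flow (P := P) (V := fun s => score (ρ s)) hφ hV hode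
      (hfs n) (hfc n) hs
    have hcf' : Continuous fun y => fderiv ℝ (f n) y (score (ρ s) y) :=
      ((hfs n).continuous_fderiv (by simp)).clm_apply (hscont s hsI)
    rw [hpush s hsI (fun y => fderiv ℝ (f n) y (score (ρ s) y)) hcf',
      integral_smul_fderiv_score hpos hd (hscont s hsI) (hfs n) (hfc n)] at hD
    have hE : HasDerivAt (fun s : ℝ => Complex.exp (-(s * ‖ξ‖ ^ 2 : ℝ)))
        (Complex.exp (-(s * ‖ξ‖ ^ 2 : ℝ)) * (-(‖ξ‖ ^ 2 : ℝ))) s := by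
      have h1 : HasDerivAt (fun s : ℝ => (-(s * ‖ξ‖ ^ 2 : ℝ) : ℂ)) (-(‖ξ‖ ^ 2 : ℝ)) s := by
        have := ((hasDerivAt_id s).mul_const (‖ξ‖ ^ 2)).neg.ofReal_comp
        simpa using this
      exact h1.cexp
    refine ⟨_, hE.mul hD, ?_⟩
    have hsd : Continuous (sumSecondDeriv (f n)) := by
      unfold sumSecondDeriv
      exact continuous_finsetSum _ fun i _ =>
        (contDiff_fderiv_apply (contDiff_fderiv_apply (hfs n) _) _).continuous
    have hsc : HasCompactSupport (sumSecondDeriv (f n)) := by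
      have h2 : ∀ i, HasCompactSupport fun x => fderiv ℝ (fun y => fderiv ℝ (f n) y
          (EuclideanSpace.basisFun (Fin m) ℝ i)) x (EuclideanSpace.basisFun (Fin m) ℝ i) :=
        fun i => hasCompactSupport_fderiv_apply (hasCompactSupport_fderiv_apply (hfc n) _) _
      obtain ⟨R, hR⟩ := (hfc n).isCompact.isBounded.subset_closedBall (0 : Ground m)
      refine HasCompactSupport.intro (isCompact_closedBall (0 : Ground m) R) fun x hx => ?_
      refine Finset.sum_eq_zero fun i _ => ?_
      have hx' : x ∉ tsupport (f n) := fun hh => hx (hR hh)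
      have h3 : x ∉ tsupport fun y => fderiv ℝ (f n) y (EuclideanSpace.basisFun (Fin m) ℝ i) :=
        fun hh => hx' (tsupport_fderiv_apply_subset ℝ _ hh)
      have h4 : x ∉ Function.support fun x => fderiv ℝ (fun y => fderiv ℝ (f n) y
          (EuclideanSpace.basisFun (Fin m) ℝ i)) x (EuclideanSpace.basisFun (Fin m) ℝ i) :=
        fun hh => h3 (tsupport_fderiv_apply_subset ℝ _ (subset_tsupport _ hh))
      exact Function.notMem_support.1 h4
    have hρc := hd.continuous
    have hi1 : Integrable fun y => ρ s y • sumSecondDeriv (f n) y :=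
      (hρc.smul hsd).integrable_of_hasCompactSupport hsc.smul_left
    have hi2 : Integrable fun y => ρ s y • f n y :=
      (hρc.smul (hfs n).continuous).integrable_of_hasCompactSupport (hfc n).smul_left
    have e : Complex.exp (-(s * ‖ξ‖ ^ 2 : ℝ)) * (-(‖ξ‖ ^ 2 : ℝ)) * (∫ x, f n (φ s x) ∂P)
          + Complex.exp (-(s * ‖ξ‖ ^ 2 : ℝ)) * -∫ x, ρ s x • sumSecondDeriv (f n) x
        = -(Complex.exp (-(s * ‖ξ‖ ^ 2 : ℝ)) *
          ∫ y, ρ s y • (sumSecondDeriv (f n) y + ‖ξ‖ ^ 2 * f n y)) := by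
      have h3 : ∫ y, ρ s y • (sumSecondDeriv (f n) y + ‖ξ‖ ^ 2 * f n y)
          = (∫ y, ρ s y • sumSecondDeriv (f n) y) + ‖ξ‖ ^ 2 * ∫ y, ρ s y • f n y := by
        rw [← integral_const_mul, ← integral_add hi1 (hi2.const_mul _)]
        refine integral_congr_ae (Filter.Eventually.of_forall fun y => ?_)
        simp only [Complex.real_smul]; ring
      rw [h3, hpush s hsI (f n) (hfs n).continuous]
      push_cast; ring
    rw [e, norm_neg, norm_mul, ← Complex.ofReal_neg, ← Complex.ofReal_exp, Complex.norm_real,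
      Real.norm_of_nonneg (Real.exp_pos _).le]
    have h4 : Real.exp (-(s * ‖ξ‖ ^ 2)) ≤ 1 :=
      Real.exp_le_one_iff.2 (neg_nonpos.2 (mul_nonneg hs.1.le (sq_nonneg _)))
    have h5 : ‖∫ y, ρ s y • (sumSecondDeriv (f n) y + ‖ξ‖ ^ 2 * f n y)‖ ≤ C / (n + 1) := by
      calc _ ≤ ∫ y, ρ s y * (C / (n + 1)) := by
            refine norm_integral_le_of_norm_le ((hρint s hsI).1.mul_const _)
              (Filter.Eventually.of_forall fun y => ?_)
            rw [norm_smul, Real.norm_of_nonneg (hpos y).le]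
            exact mul_le_mul_of_nonneg_left (hC n y) (hpos y).le
        _ = _ := by rw [integral_mul_const, (hρint s hsI).2, one_mul]
    calc _ ≤ 1 * (C / (n + 1)) := by gcongr
      _ = _ := one_mul _
  have hlim : ∀ s ∈ Ico 0 T, Filter.Tendsto (fun n => F n s) Filter.atTop
      (𝓝 (Complex.exp (-(s * ‖ξ‖ ^ 2 : ℝ)) * ∫ x, planeWave ξ (φ s x) ∂P)) := by
    intro s hs
    refine Filter.Tendsto.const_mul _ ?_
    refine tendsto_integral_of_dominated_convergence (fun _ => 1)
      (fun n => ((hfs n).continuous.measurable.comp (hφ s hs)).aestronglyMeasurable)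
      (integrable_const _) (fun n => Filter.Eventually.of_forall fun x => hf1 n _)
      (Filter.Eventually.of_forall fun x => ?_)
    simpa [hf_def] using (tendsto_cutoff (φ s x)).smul_const (planeWave ξ (φ s x))
  set H : ℝ → ℂ := fun s => Complex.exp (-(s * ‖ξ‖ ^ 2 : ℝ)) * ∫ x, planeWave ξ (φ s x) ∂P
    with hH
  -- On [a, t] with a > 0 the derivatives are two-sided; time 0 is reached afterwards through
  -- continuity of the orbits and dominated convergence.
  have hconst : ∀ a ∈ Ioo 0 t, H a = H t := by
    intro a ha
    have hat : ∀ s ∈ Icc a t, s ∈ Ioo 0 T := fun s hs =>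
      ⟨ha.1.trans_le hs.1, hs.2.trans_lt ht.2⟩
    have hle : ∀ n : ℕ, ‖F n t - F n a‖ ≤ C / (n + 1) * (t - a) := by
      intro n
      choose! F' hF' hFn using hderiv n
      exact norm_image_sub_le_of_norm_deriv_le_segment'
        (fun s hs => (hF' s (hat s hs)).hasDerivWithinAt)
        (fun s hs => hFn s (hat s (Ico_subset_Icc_self hs))) t (right_mem_Icc.2 ha.2.le)
    have hz : Filter.Tendsto (fun n : ℕ => C / ((n : ℝ) + 1) * (t - a)) Filter.atTop (𝓝 0) := by
      have := (tendsto_one_div_add_atTop_nhds_zero_nat (𝕜 := ℝ)).const_mul C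
      have := this.mul_const (t - a)
      simpa [div_eq_mul_inv] using this
    have hl := ((hlim t ht).sub (hlim a ⟨ha.1.le, ha.2.trans ht.2⟩)).norm
    have := le_of_tendsto_of_tendsto' hl hz hle
    exact (sub_eq_zero.1 (norm_le_zero_iff.1 this)).symm
  have hpw := (contDiff_planeWave ξ).continuous
  have hH0 : H 0 = charFun P ξ := by
    rw [hH, charFun_apply]
    simp only [zero_mul, Complex.ofReal_zero, neg_zero, Complex.exp_zero, one_mul, h0]
    rfl
  have hHt : H t = Complex.exp (-(t * ‖ξ‖ ^ 2 : ℝ)) * charFun (P.map (φ t)) ξ := by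
    rw [hH, charFun_apply, integral_map (hφ t ht).aemeasurable (by exact hpw.aestronglyMeasurable)]
    rfl
  rw [← hHt, ← hH0]
  rcases ht.1.eq_or_lt with rfl | htpos
  · rfl
  have hcont : Filter.Tendsto H (𝓝[Ioo 0 t] 0) (𝓝 (H 0)) := by
    have hsub : Ioo 0 t ⊆ Ico 0 T := fun s hs => ⟨hs.1.le, hs.2.trans ht.2⟩
    refine Filter.Tendsto.mul ?_ ?_
    · exact (Continuous.tendsto (by fun_prop) 0).mono_left nhdsWithin_le_nhds
    · refine tendsto_integral_filter_of_dominated_convergence (fun _ => 1) ?_ ?_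
        (integrable_const _) ?_
      · filter_upwards [self_mem_nhdsWithin] with s hs
        exact (hpw.measurable.comp (hφ s (hsub hs))).aestronglyMeasurable
      · exact Filter.Eventually.of_forall fun s =>
          Filter.Eventually.of_forall fun x => (norm_planeWave _ _).le
      · refine Filter.Eventually.of_forall fun x => ?_
        have h1 : ContinuousWithinAt (fun s => φ s x) (Ioo 0 t) 0 :=
          (hode x 0 ⟨le_rfl, htpos.trans ht.2⟩).continuousWithinAt.mono hsub
        exact (hpw.tendsto _).comp h1
  have hne : (𝓝[Ioo 0 t] (0 : ℝ)).NeBot := by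
    rw [← mem_closure_iff_nhdsWithin_neBot, closure_Ioo htpos.ne]
    exact left_mem_Icc.2 htpos.le
  refine (tendsto_nhds_unique hcont (tendsto_const_nhds.congr' ?_)).symm
  filter_upwards [self_mem_nhdsWithin] with s hs
  exact (hconst s hs).symm

end BackwardHeat

/-! ### The continuous denoising autoencoder -/

section Continuous

variable {m K : ℕ}

theorem norm_matAct_inv_le {S : Matrix (Fin m) (Fin m) ℝ} {κ : ℝ} (hS : S.PosDef)
    (h0 : 0 < κ) (hκ : (S - κ • (1 : Matrix (Fin m) (Fin m) ℝ)).PosSemidef) (u : Ground m) :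
    ‖matAct S⁻¹ u‖ ≤ ‖u‖ / κ := by
  have h1 := mul_norm_sq_matAct_inv_le hS hκ 0 u
  have h2 := mul_mahalanobisSq_le_norm_sq hS h0.le hκ 0 u
  rw [sub_zero] at h1 h2
  rw [le_div_iff₀ h0]
  refine abs_le_of_sq_le_sq' ?_ (norm_nonneg u) |>.2
  have h3 := mul_le_mul_of_nonneg_left h1 h0.le
  nlinarith

theorem Matrix.PosDef.matAct_inv_of_eigen {S : Matrix (Fin m) (Fin m) ℝ} (hS : S.PosDef) {c : ℝ}
    {b : Ground m} (hc : c ≠ 0) (h : matAct S b = c • b) : matAct S⁻¹ b = c⁻¹ • b := by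
  have h1 := hS.matAct_inv_cancel b
  rw [h, matAct_smul] at h1
  rw [← h1, smul_smul, inv_mul_cancel₀ hc, one_smul, h1]

/-- The vector w = √A b - √c b satisfies √A w = -√c w, which a positive semidefinite √A allows only
for w = 0. -/
theorem matAct_sqrt_of_eigen {A : Matrix (Fin m) (Fin m) ℝ} (hA : A.PosSemidef) {c : ℝ}
    (hc : 0 < c) {b : Ground m} (h : matAct A b = c • b) :
    matAct (CFC.sqrt A) b = Real.sqrt c • b := by
  have hB := posSemidef_sqrt A
  have hBB : matAct (CFC.sqrt A) (matAct (CFC.sqrt A) b) = c • b := by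
    rw [← mul_matAct, CFC.sqrt_mul_sqrt_self A hA.nonneg, h]
  set w := matAct (CFC.sqrt A) b - Real.sqrt c • b with hw
  have hs : 0 < Real.sqrt c := Real.sqrt_pos.2 hc
  have h1 : matAct (CFC.sqrt A) w = -(Real.sqrt c • w) := by
    rw [hw, matAct_sub, matAct_smul, hBB, smul_sub, smul_smul, Real.mul_self_sqrt hc.le]
    abel
  have h2 := hB.inner_matAct_nonneg w
  rw [h1, inner_neg_right, inner_smul_right, real_inner_self_eq_norm_sq] at h2
  have h3 : ‖w‖ ^ 2 = 0 := by nlinarith [sq_nonneg ‖w‖]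
  exact sub_eq_zero.1 (norm_eq_zero.1 (pow_eq_zero_iff two_ne_zero |>.1 h3))

/-- Interpolation between a small ratio at a center and the Gaussian tail. -/
theorem pow_eight_le_of_gaussian_tail {γ a q Q c D D' ε κ : ℝ} (hc : 0 ≤ c) (hD : 0 ≤ D)
    (hκ : 0 < κ) (hε : 0 ≤ ε) (hq : 0 ≤ q) (hqQ : q ≤ Q) (hγ : γ ^ 2 ≤ q * Real.exp (c - D))
    (hqD : q * Real.exp (-D') ≤ 4 * ε) (hDD : D' ≤ 2 * D + 2 * c)
    (ha : a ^ 2 ≤ 2 * ((c + D) / κ)) :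
    (γ * a) ^ 8 ≤ ε * (Q ^ 3 * Real.exp (6 * c) * 4 * (16 / κ ^ 4) *
      (Nat.factorial 4 * Real.exp c)) := by
  have hQ : 0 ≤ Q := hq.trans hqQ
  have hγ8 : γ ^ 8 ≤ Q ^ 3 * Real.exp (6 * c) * (4 * ε) * Real.exp (-D) := by
    calc γ ^ 8 = (γ ^ 2) ^ 4 := by ring
      _ ≤ (q * Real.exp (c - D)) ^ 4 := pow_le_pow_left₀ (sq_nonneg γ) hγ 4
      _ = q ^ 3 * (q * Real.exp (4 * c - 4 * D)) := by
          rw [mul_pow, ← Real.exp_nat_mul]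
          push_cast
          rw [show (4 : ℝ) * (c - D) = 4 * c - 4 * D by ring]; ring
      -- From D' ≤ 2D + 2c and D ≥ 0 one gets 4c - 4D ≤ 6c - D' - D; exp(-D') pairs with q to
      -- produce ε, and exp(-D) is kept to absorb the growth of a.
      _ ≤ Q ^ 3 * (q * Real.exp (6 * c + -D' + -D)) := by
          gcongr; linarith
      _ = Q ^ 3 * Real.exp (6 * c) * (q * Real.exp (-D')) * Real.exp (-D) := by
          rw [Real.exp_add, Real.exp_add]; ring
      _ ≤ _ := by gcongr
  calc (γ * a) ^ 8 = γ ^ 8 * (a ^ 2) ^ 4 := by ring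
    _ ≤ (Q ^ 3 * Real.exp (6 * c) * (4 * ε) * Real.exp (-D)) * (2 * ((c + D) / κ)) ^ 4 := by
        gcongr
    _ = ε * (Q ^ 3 * Real.exp (6 * c) * 4 * (16 / κ ^ 4) *
          (((c + D) ^ 4 * Real.exp (-(c + D))) * Real.exp c)) := by
        rw [mul_assoc ((c + D) ^ 4), ← Real.exp_add,
          show -(c + D) + c = -D by ring, mul_pow, div_pow]
        ring
    _ ≤ _ := by
        have h := mul_le_mul_of_nonneg_right (pow_mul_exp_neg_le (add_nonneg hc hD) 4)
          (Real.exp_pos c).le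
        have hA : 0 ≤ Q ^ 3 * Real.exp (6 * c) * 4 * (16 / κ ^ 4) := by positivity
        exact mul_le_mul_of_nonneg_left (mul_le_mul_of_nonneg_left h hA) hε

namespace GaussianMixture

variable (G : GaussianMixture m K)

theorem charFun_gaussianSum {S : Fin K → Matrix (Fin m) (Fin m) ℝ} (ξ : Ground m) :
    charFun (gaussianSum G.weight G.mean S) ξ
      = ∑ k, G.weight k • charFun (multivariateGaussian (G.mean k) (S k)) ξ := by
  simp only [charFun_apply]
  refine G.integral_gaussianSum _ fun k => ?_
  refine Integrable.of_bound (C := 1) (by fun_prop) (Filter.Eventually.of_forall fun x => ?_)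
  rw [Complex.norm_exp_ofReal_mul_I]

/-- Subtracting 2tI from a covariance multiplies the Gaussian characteristic function by exp(t|ξ|²),
the factor the backward heat flow produces. -/
theorem map_of_isContinuousDAE {T : ℝ} {φ : ℝ → Ground m → Ground m}
    (h : IsContinuousDAE G.law T φ) {t : ℝ} (ht : t ∈ Ico 0 T)
    (hpos : ∀ k, (G.contCov t k).PosDef) :
    G.law.map (φ t) = gaussianSum G.weight G.mean (G.contCov t) := by
  have := Measure.isProbabilityMeasure_map (μ := G.law) (h.2.1 t ht).aemeasurable
  refine Measure.ext_of_charFun ?_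
  ext ξ
  have h1 := charFun_map_of_isContinuousDAE h ht ξ
  have h2 : Complex.exp (-(t * ‖ξ‖ ^ 2 : ℝ)) *
      charFun (gaussianSum G.weight G.mean (G.contCov t)) ξ = charFun G.law ξ := by
    rw [law, charFun_gaussianSum, charFun_gaussianSum, Finset.mul_sum]
    refine Finset.sum_congr rfl fun k _ => ?_
    rw [charFun_multivariateGaussian (hpos k).posSemidef,
      charFun_multivariateGaussian (G.cov_posDef k).posSemidef, mul_smul_comm, ← Complex.exp_add]
    congr 2
    have h3 : ξ.ofLp ⬝ᵥ G.contCov t k *ᵥ ξ.ofLp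
        = ξ.ofLp ⬝ᵥ G.cov k *ᵥ ξ.ofLp - 2 * t * ‖ξ‖ ^ 2 := by
      rw [← inner_matAct, ← inner_matAct, contCov, sub_matAct, smul_matAct, one_matAct,
        inner_sub_right, inner_smul_right, real_inner_self_eq_norm_sq]
    rw [h3]
    push_cast; ring
  exact mul_left_cancel₀ (Complex.exp_ne_zero _) (h1.trans h2.symm)

/-- The velocity field of a continuous denoising autoencoder is the score of a Gaussian mixture. -/
theorem density_eq_of_isContinuousDAE {T : ℝ} {φ : ℝ → Ground m → Ground m}
    (h : IsContinuousDAE G.law T φ) {t : ℝ} (ht : t ∈ Ico 0 T)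
    (hpos : ∀ k, (G.contCov t k).PosDef) {ρ : Ground m → ℝ} (hρ : ∀ x, 0 < ρ x)
    (hd : Differentiable ℝ ρ)
    (hmap : G.law.map (φ t) = volume.withDensity (fun x => ENNReal.ofReal (ρ x))) :
    ρ = G.mixDensity (G.contCov t) := by
  rw [G.map_of_isContinuousDAE h ht hpos, G.gaussianSum_eq_withDensity hpos] at hmap
  have hc := G.continuous_mixDensity (G.contCov t)
  have hfin : ∫⁻ x, ENNReal.ofReal (G.mixDensity (G.contCov t) x) ≠ ⊤ := by
    rw [← setLIntegral_univ, ← withDensity_apply _ MeasurableSet.univ,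
      ← G.gaussianSum_eq_withDensity hpos]
    exact measure_ne_top _ _
  have hae := (withDensity_eq_iff hc.measurable.ennreal_ofReal.aemeasurable
    hd.continuous.measurable.ennreal_ofReal.aemeasurable hfin).1 hmap
  -- Both densities are continuous, so equality almost everywhere is equality everywhere, as needed
  -- to compare scores pointwise.
  have heq := ((ENNReal.continuous_ofReal.comp hc).ae_eq_iff_eq
    volume (ENNReal.continuous_ofReal.comp hd.continuous)).1 hae
  ext x
  exact ((ENNReal.ofReal_eq_ofReal_iff (G.mixDensity_pos hpos x).le (hρ x).le).1
    (congrFun heq x)).symm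

/-- The mixture density cancels in the ratio of two responsibilities; squaring removes the square
roots of the determinants. The coefficient does not depend on `x`, which links a point to the
center. -/
theorem resp_sq_mul_exp {S : Fin K → Matrix (Fin m) (Fin m) ℝ} (hS : ∀ k, (S k).PosDef)
    (j k : Fin K) (hk : G.weight k ≠ 0) (x : Ground m) :
    G.resp S j x ^ 2 * Real.exp (-mahalanobisSq (G.mean k) (S k) x)
      = G.weight j ^ 2 * (S k).det / (G.weight k ^ 2 * (S j).det) * G.resp S k x ^ 2 *
        Real.exp (-mahalanobisSq (G.mean j) (S j) x) := by
  have e : ∀ i, gaussianDensity (G.mean i) (S i) x ^ 2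
        = ((2 * Real.pi) ^ m * (S i).det)⁻¹ * Real.exp (-mahalanobisSq (G.mean i) (S i) x) := by
    intro i
    have := (hS i).det_pos
    rw [gaussianDensity, mul_pow, inv_pow, Real.sq_sqrt (by positivity), ← Real.exp_nat_mul]
    congr 2; push_cast; ring
  have hj := (hS j).det_pos.ne'
  have hk' := (hS k).det_pos.ne'
  have hZ := (G.mixDensity_pos hS x).ne'
  rw [resp_eq, resp_eq, div_pow, div_pow, mul_pow, mul_pow, e, e]
  field_simp

/-- If the responsibility of a component is almost `1` at its center, then near the center the
score of the mixture is almost the score of that component. -/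
theorem exists_norm_score_sub_le (m K : ℕ) {κ R w b η : ℝ} (hκ : 0 < κ) (hR : 0 < R) (hw : 0 < w)
    (hb : 0 < b) (hη : 0 < η) :
    ∃ ε : ℝ, 0 < ε ∧ ∀ (G : GaussianMixture m K) (S : Fin K → Matrix (Fin m) (Fin m) ℝ),
      (∀ k, (S k).PosDef) → (∀ k, (S k - κ • (1 : Matrix (Fin m) (Fin m) ℝ)).PosSemidef) →
      (∀ k, (R • (1 : Matrix (Fin m) (Fin m) ℝ) - S k).PosSemidef) →
      ∀ k, w ≤ G.weight k → 1 - ε ≤ G.resp S k (G.mean k) → ∀ y, ‖y - G.mean k‖ ≤ b →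
        ‖score (G.mixDensity S) y + matAct (S k)⁻¹ (y - G.mean k)‖ ≤ η := by
  set c : ℝ := b ^ 2 / κ with hc
  have hc0 : 0 < c := by positivity
  set Q : ℝ := R ^ m / (w ^ 2 * κ ^ m) with hQ
  have hQ0 : 0 < Q := by positivity
  set C : ℝ := Q ^ 3 * Real.exp (6 * c) * 4 * (16 / κ ^ 4) * (Nat.factorial 4 * Real.exp c)
    with hC
  obtain ⟨ε, hε, hε1, hεA, hεB⟩ := exists_pos_le_one_mul_le 1 C
    (a := 1 / 2) (b := (η / (K + 1)) ^ 8) (by positivity) (by positivity)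
  refine ⟨ε, hε, fun G S hS hlow hup k hk hresp y hy => ?_⟩
  have hk0 : 0 < G.weight k := hw.trans_le hk
  have hDk : mahalanobisSq (G.mean k) (S k) y ≤ c := by
    rw [hc, le_div_iff₀ hκ, mul_comm]
    exact (mul_mahalanobisSq_le_norm_sq (hS k) hκ.le (hlow k) _ _).trans (by gcongr)
  have hterm : ∀ j ∈ Finset.univ.erase k, G.resp S j y *
      (‖matAct (S k)⁻¹ (y - G.mean k)‖ + ‖matAct (S j)⁻¹ (y - G.mean j)‖) ≤ η / (K + 1) := by
    intro j hj
    have hγμ := G.resp_le_of_ne hS (Finset.ne_of_mem_erase hj) hresp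
    have hγμ0 := G.resp_nonneg hS j (G.mean k)
    have hγ0 := G.resp_nonneg hS j y
    have hγk0 := G.resp_nonneg hS k y
    have hγk1 := G.resp_le_one hS k y
    set q := G.weight j ^ 2 * (S k).det / (G.weight k ^ 2 * (S j).det) with hq
    have hdj := (hS j).det_pos
    have hdk := (hS k).det_pos
    have hq0 : 0 ≤ q := by positivity
    have hqQ : q ≤ Q := by
      have h1 : G.weight j ^ 2 ≤ 1 := pow_le_one₀ (G.weight_nonneg j) (G.weight_le_one j)
      have h2 := det_le_pow (hS k).posSemidef (hup k)
      have h3 := pow_le_det hκ.le (hS j).1 (hlow j)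
      calc q ≤ 1 * R ^ m / (w ^ 2 * κ ^ m) := by rw [hq]; gcongr
        _ = Q := by rw [one_mul]
    have hy1 := G.resp_sq_mul_exp hS j k hk0.ne' y
    have hμ1 := G.resp_sq_mul_exp hS j k hk0.ne' (G.mean k)
    rw [← hq] at hy1 hμ1
    clear_value q
    have hDkμ : mahalanobisSq (G.mean k) (S k) (G.mean k) = 0 := by
      simp [mahalanobisSq_eq_inner]
    rw [hDkμ, neg_zero, Real.exp_zero, mul_one] at hμ1
    set γ := G.resp S j y
    set D := mahalanobisSq (G.mean j) (S j) y with hD_def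
    set D' := mahalanobisSq (G.mean j) (S j) (G.mean k)
    have hD : 0 ≤ D := (hS j).mahalanobisSq_nonneg _ _
    have hDD' : D' ≤ 2 * D + 2 * c := by
      refine (mahalanobisSq_le_two_mul (hS j) _ _ y).trans ?_
      have : mahalanobisSq y (S j) (G.mean k) ≤ c := by
        rw [hc, le_div_iff₀ hκ, mul_comm]
        refine (mul_mahalanobisSq_le_norm_sq (hS j) hκ.le (hlow j) _ _).trans ?_
        rw [norm_sub_rev]; gcongr
      linarith
    have hγsq : γ ^ 2 ≤ q * Real.exp (c - D) := by
      have e1 : γ ^ 2 = q * G.resp S k y ^ 2 * Real.exp (-D) *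
          Real.exp (mahalanobisSq (G.mean k) (S k) y) := by
        rw [← hy1, mul_assoc, ← Real.exp_add, neg_add_cancel, Real.exp_zero, mul_one]
      rw [e1]
      calc _ ≤ q * 1 * Real.exp (-D) * Real.exp c := by
            have := pow_le_one₀ (n := 2) hγk0 hγk1
            gcongr
        _ = _ := by rw [mul_one, mul_assoc, ← Real.exp_add]; congr 2; ring
    -- At the center the ratio identity reads γ_j² = q γ_k² exp(-D'), with γ_j ≤ ε ≤ 1 and γ_k ≥
    -- 1/2; the latter is the origin of the 4.
    have hqD' : q * Real.exp (-D') ≤ 4 * ε := by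
      have h1 : (1 / 2 : ℝ) ≤ G.resp S k (G.mean k) := by linarith
      have h2 : (1 / 2 : ℝ) ^ 2 ≤ G.resp S k (G.mean k) ^ 2 := by gcongr
      have h3 : G.resp S j (G.mean k) ^ 2 ≤ ε := by
        calc G.resp S j (G.mean k) ^ 2 ≤ ε ^ 2 := by gcongr
          _ ≤ ε := by rw [sq]; exact mul_le_of_le_one_left hε.le hε1
      rw [hμ1, mul_right_comm] at h3
      have h4 := (mul_le_mul_of_nonneg_left h2
        (mul_nonneg hq0 (Real.exp_pos (-D')).le)).trans h3
      linarith only [h4]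
    set a := ‖matAct (S k)⁻¹ (y - G.mean k)‖ + ‖matAct (S j)⁻¹ (y - G.mean j)‖ with ha
    have ha2 : a ^ 2 ≤ 2 * ((c + D) / κ) := by
      have h1 := mul_norm_sq_matAct_inv_le (hS k) (hlow k) (G.mean k) y
      have h2 := mul_norm_sq_matAct_inv_le (hS j) (hlow j) (G.mean j) y
      rw [← mul_div_assoc, le_div_iff₀ hκ]
      calc a ^ 2 * κ ≤ 2 * (‖matAct (S k)⁻¹ (y - G.mean k)‖ ^ 2 +
            ‖matAct (S j)⁻¹ (y - G.mean j)‖ ^ 2) * κ := by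
              gcongr; exact add_sq_le
        _ ≤ _ := by linarith
    have hpow : (γ * a) ^ 8 ≤ (η / (K + 1)) ^ 8 :=
      (pow_eight_le_of_gaussian_tail hc0.le hD hκ hε.le hq0 hqQ hγsq hqD' hDD' ha2).trans hεB
    exact le_of_pow_le_pow_left₀ (by norm_num) (by positivity) hpow
  refine (G.norm_score_sub_le hS k y).trans ?_
  -- The defect 1 - γ_k is spread over the other components, which is why `hterm` carries the k-th
  -- vector as well.
  have h1 : 1 - G.resp S k y = ∑ j ∈ Finset.univ.erase k, G.resp S j y := by
    have := G.sum_resp hS y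
    rw [← Finset.add_sum_erase _ _ (Finset.mem_univ k)] at this
    linarith
  rw [h1, Finset.sum_mul, ← Finset.sum_add_distrib]
  simp_rw [← mul_add]
  refine (Finset.sum_le_card_nsmul _ _ _ hterm).trans ?_
  have hcard : ((Finset.univ.erase k).card : ℝ) ≤ K + 1 := by
    have : (Finset.univ.erase k).card ≤ K := by simp
    have : ((Finset.univ.erase k).card : ℝ) ≤ K := by exact_mod_cast this
    linarith
  rw [nsmul_eq_mul]
  calc _ ≤ ((K : ℝ) + 1) * (η / (K + 1)) := by gcongr
    _ = η := by field_simp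

/-- The affine model solves the equation of the continuous autoencoder for a single component. -/
theorem hasDerivAt_contAffine {s : ℝ} (k : Fin K) (hs : (G.contCov s k).PosDef) (x : Ground m) :
    HasDerivAt (fun s => G.contAffine s k x)
      (-matAct (G.contCov s k)⁻¹ (G.contAffine s k x - G.mean k)) s := by
  have hcov := G.cov_posDef k
  set b := hcov.1.eigenvectorBasis with hb
  set σ := hcov.1.eigenvalues with hσ_def
  have hσ : ∀ i, 0 < σ i := fun i => hcov.eigenvalues_pos i
  have heig : ∀ i, matAct (G.cov k) (b i) = σ i • b i := by
    intro i
    have := hcov.1.mulVec_eigenvectorBasis i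
    rw [matAct, this]; rfl
  have hcont : ∀ s i, matAct (G.contCov s k) (b i) = (σ i - 2 * s) • b i := by
    intro s i
    rw [contCov, sub_matAct, smul_matAct, one_matAct, heig, sub_smul]
  have hpos : ∀ s, (G.contCov s k).PosDef → ∀ i, 0 < σ i - 2 * s := by
    intro s hs i
    have h := hs.inner_matAct_pos (x := b i) (b.orthonormal.ne_zero i)
    rwa [hcont, inner_smul_right, real_inner_self_eq_norm_sq, b.norm_eq_one, one_pow,
      mul_one] at h
  set v := x - G.mean k
  have hsqrt : ∀ s, (G.contCov s k).PosDef →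
      matAct (CFC.sqrt (1 - (2 * s) • (G.cov k)⁻¹)) v
        = ∑ i, (Real.sqrt (1 - 2 * s / σ i) * inner ℝ (b i) v) • b i := by
    intro s hs
    have hM := posSemidef_one_sub_smul_inv hcov hs.posSemidef
    conv_lhs => rw [← b.sum_repr' v]
    rw [matAct_eq_toEuclideanCLM, map_sum]
    refine Finset.sum_congr rfl fun i _ => ?_
    rw [map_smul, ← matAct_eq_toEuclideanCLM, matAct_sqrt_of_eigen hM (c := 1 - 2 * s / σ i),
      smul_smul, mul_comm]
    · have h1 : 1 - 2 * s / σ i = (σ i - 2 * s) / σ i := by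
        rw [sub_div, div_self (hσ i).ne']
      rw [h1]; exact div_pos (hpos s hs i) (hσ i)
    · rw [sub_matAct, smul_matAct, one_matAct, hcov.matAct_inv_of_eigen (hσ i).ne' (heig i),
        smul_smul, sub_smul, one_smul, div_eq_mul_inv]
  -- The derivative is two-sided, so the diagonal formula is needed on both sides of `s`; the
  -- finitely many eigenvalues σ_i - 2s' stay positive nearby.
  have hopen : ∀ᶠ s' in 𝓝 s, (G.contCov s' k).PosDef := by
    have h1 : ∀ i, ∀ᶠ s' in 𝓝 s, 0 < σ i - 2 * s' := fun i =>
      (continuous_const.sub (continuous_const.mul continuous_id)).tendsto s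
        |>.eventually_const_lt (hpos s hs i)
    filter_upwards [Filter.eventually_all.2 h1] with s' hs'
    have hherm : (G.contCov s' k).IsHermitian := by
      have h2 : (G.contCov s' k)ᴴ = G.contCov s' k := by
        rw [contCov, Matrix.conjTranspose_sub, hcov.1.eq]; simp
      exact h2
    refine Matrix.PosDef.of_dotProduct_mulVec_pos hherm fun y hy => ?_
    set u : Ground m := WithLp.toLp 2 y with hu
    have hu0 : u ≠ 0 := by simpa [hu] using hy
    have h2 : star y ⬝ᵥ G.contCov s' k *ᵥ y = inner ℝ u (matAct (G.contCov s' k) u) := by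
      rw [inner_matAct]; simp [hu]
    rw [h2]
    have h3 : inner ℝ u (matAct (G.contCov s' k) u)
        = ∑ i, (σ i - 2 * s') * inner ℝ (b i) u ^ 2 := by
      have hh : matAct (G.contCov s' k) u = ∑ i, ((σ i - 2 * s') * inner ℝ (b i) u) • b i := by
        conv_lhs => rw [← b.sum_repr' u]
        rw [matAct_eq_toEuclideanCLM, map_sum]
        refine Finset.sum_congr rfl fun i _ => ?_
        rw [map_smul, ← matAct_eq_toEuclideanCLM, hcont, smul_smul, mul_comm]
      rw [hh, inner_sum]
      refine Finset.sum_congr rfl fun i _ => ?_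
      rw [inner_smul_right, real_inner_comm]; ring
    rw [h3]
    obtain ⟨i, hi⟩ : ∃ i, inner ℝ (b i) u ≠ 0 := by
      by_contra! hall
      refine hu0 ?_
      rw [← b.sum_repr' u]
      simp [hall]
    exact Finset.sum_pos' (fun i _ => mul_nonneg (hs' i).le (sq_nonneg _))
      ⟨i, Finset.mem_univ i, mul_pos (hs' i) (by positivity)⟩
  have heq : (fun s' => G.contAffine s' k x) =ᶠ[𝓝 s]
      fun s' => (∑ i, (Real.sqrt (1 - 2 * s' / σ i) * inner ℝ (b i) v) • b i) + G.mean k := by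
    filter_upwards [hopen] with s' hs'
    rw [contAffine, hsqrt s' hs']
  refine HasDerivAt.congr_of_eventuallyEq ?_ heq
  have hder : ∀ i, HasDerivAt (fun s' => (Real.sqrt (1 - 2 * s' / σ i) * inner ℝ (b i) v) • b i)
      (-((σ i - 2 * s)⁻¹ • ((Real.sqrt (1 - 2 * s / σ i) * inner ℝ (b i) v) • b i))) s := by
    intro i
    have hp := hpos s hs i
    have h1 : 1 - 2 * s / σ i = (σ i - 2 * s) / σ i := by
      rw [sub_div, div_self (hσ i).ne']
    have h2 : 0 < 1 - 2 * s / σ i := by rw [h1]; exact div_pos hp (hσ i)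
    have h3 : HasDerivAt (fun s' : ℝ => 1 - 2 * s' / σ i) (-(2 / σ i)) s := by
      have := (((hasDerivAt_id s).const_mul 2).div_const (σ i)).const_sub 1
      simpa using this
    refine (((h3.sqrt h2.ne').mul_const (inner ℝ (b i) v)).smul_const (b i)).congr_deriv ?_
    rw [smul_smul, ← neg_smul]
    congr 1
    have h4 : Real.sqrt (1 - 2 * s / σ i) ≠ 0 := (Real.sqrt_pos.2 h2).ne'
    -- Expressed through z = √(1 - 2s/σ_i), the scalar equation becomes a rational identity in z.
    have h5 : (σ i - 2 * s)⁻¹ = (σ i * Real.sqrt (1 - 2 * s / σ i) ^ 2)⁻¹ := by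
      rw [Real.sq_sqrt h2.le, h1, mul_div_cancel₀ _ (hσ i).ne']
    have h6 := (hσ i).ne'
    rw [h5]
    generalize Real.sqrt (1 - 2 * s / σ i) = z at h4
    field_simp
  refine ((HasDerivAt.fun_sum fun i (_ : i ∈ Finset.univ) => hder i).add_const _).congr_deriv ?_
  rw [contAffine, add_sub_cancel_right, hsqrt s hs, matAct_eq_toEuclideanCLM, map_sum,
    ← Finset.sum_neg_distrib]
  refine Finset.sum_congr rfl fun i _ => ?_
  rw [map_smul, ← matAct_eq_toEuclideanCLM,
    hs.matAct_inv_of_eigen (hpos s hs i).ne' (hcont s i), smul_comm]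

/-- Keeps the affine orbit inside a fixed ball around the center, where the score estimate is
available. -/
theorem norm_contAffine_sub_le {s : ℝ} (h0 : 0 ≤ s) (k : Fin K)
    (hs : (G.contCov s k).PosSemidef) (x : Ground m) :
    ‖G.contAffine s k x - G.mean k‖ ≤ ‖x - G.mean k‖ := by
  have hcov := G.cov_posDef k
  refine abs_le_of_sq_le_sq' ?_ (norm_nonneg _) |>.2
  rw [contAffine, add_sub_cancel_right, norm_matAct_sqrt_sq (posSemidef_one_sub_smul_inv hcov hs),
    sub_matAct, smul_matAct, one_matAct, inner_sub_right, inner_smul_right,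
    real_inner_self_eq_norm_sq]
  have := mul_nonneg (mul_nonneg zero_le_two h0)
    (hcov.inv.posSemidef.inner_matAct_nonneg (x - G.mean k))
  linarith

theorem contAffine_zero (k : Fin K) : G.contAffine 0 k = id := by
  ext1 x
  simp [contAffine]

theorem exists_norm_flow_sub_contAffine_le (m K : ℕ) {κ R w r δ : ℝ} (hκ : 0 < κ) (hR : 0 < R)
    (hw : 0 < w) (hr : 0 < r) (hδ : 0 < δ) :
    ∃ ε : ℝ, 0 < ε ∧
      ∀ (G : GaussianMixture m K) (T : ℝ) (φ : ℝ → Ground m → Ground m) (t : ℝ)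
        (Ω : Fin K → Set (Ground m)),
        (∀ k, (R • (1 : Matrix (Fin m) (Fin m) ℝ) - G.cov k).PosSemidef) →
        IsContinuousDAE G.law T φ → t ∈ Set.Ico 0 T →
        (∀ k, (G.contCov t k - κ • (1 : Matrix (Fin m) (Fin m) ℝ)).PosSemidef) →
        (∀ s ∈ Set.Icc 0 t, G.WellSeparated (G.contCov s) Ω ε) →
        ∀ k, w ≤ G.weight k → ∀ x, mahalanobisSq (G.mean k) (G.cov k) x ≤ r ^ 2 →
          ‖φ t x - G.contAffine t k x‖ ≤ δ := by
  -- The affine field is Lipschitz with constant 1/κ; the extra 1 leaves the barrier δ exp(c(s - t))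
  -- room for the score error η, which is below half of its minimum as t ≤ R.
  set c : ℝ := 1 / κ + 1 with hc
  have hc0 : 0 < c := by positivity
  set η : ℝ := δ / 2 * Real.exp (-(c * R)) with hη
  obtain ⟨ε, hε, hscore⟩ := exists_norm_score_sub_le m K hκ hR hw
    (b := δ + Real.sqrt R * r) (η := η) (by positivity) (by positivity)
  refine ⟨ε, hε, fun G T φ t Ω hup hdae ht hlow hsep k hk x hx => ?_⟩
  -- In dimension zero the matrix bounds do not imply t ≤ R, but the space is a point.
  rcases Nat.eq_zero_or_pos m with rfl | hm
  · rw [Subsingleton.elim (φ t x) (G.contAffine t k x), sub_self, norm_zero]; exact hδ.le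
  have hlow' : ∀ s ∈ Icc 0 t, ∀ j,
      (G.contCov s j - κ • (1 : Matrix (Fin m) (Fin m) ℝ)).PosSemidef := by
    intro s hs j
    convert (hlow j).add (posSemidef_smul_one (m := m) (c := 2 * (t - s)) (by linarith [hs.2]))
      using 1
    simp only [contCov]; module
  have hup' : ∀ s ∈ Icc 0 t, ∀ j,
      (R • (1 : Matrix (Fin m) (Fin m) ℝ) - G.contCov s j).PosSemidef := by
    intro s hs j
    convert (hup j).add (posSemidef_smul_one (m := m) (c := 2 * s) (by linarith [hs.1])) using 1
    simp only [contCov]; module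
  have hpos : ∀ s ∈ Icc 0 t, ∀ j, (G.contCov s j).PosDef := by
    intro s hs j
    have := Matrix.PosDef.posSemidef_add (hlow' s hs j) (Matrix.PosDef.one.smul hκ)
    rwa [sub_add_cancel] at this
  have htR : t ≤ R := by
    have e1 : ‖(EuclideanSpace.basisFun (Fin m) ℝ ⟨0, hm⟩ : Ground m)‖ = 1 :=
      (EuclideanSpace.basisFun (Fin m) ℝ).norm_eq_one _
    have h1 := inner_matAct_le_of_le (hup k) (EuclideanSpace.basisFun (Fin m) ℝ ⟨0, hm⟩)
    have h2 := le_inner_matAct_of_le (hlow k) (EuclideanSpace.basisFun (Fin m) ℝ ⟨0, hm⟩)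
    rw [contCov, sub_matAct, smul_matAct, one_matAct, inner_sub_right, inner_smul_right,
      real_inner_self_eq_norm_sq, e1] at h2
    rw [e1] at h1
    have := ht.1
    linarith
  have hdae' := hdae
  obtain ⟨h0, -, ρ, hρ, -, hode⟩ := hdae'
  have hsT : ∀ s ∈ Icc 0 t, s ∈ Ico 0 T := fun s hs => ⟨hs.1, hs.2.trans_lt ht.2⟩
  have hscore_eq : ∀ s ∈ Icc 0 t, ρ s = G.mixDensity (G.contCov s) := fun s hs =>
    G.density_eq_of_isContinuousDAE hdae (hsT s hs) (hpos s hs) (hρ s (hsT s hs)).1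
      (hρ s (hsT s hs)).2.1 (hρ s (hsT s hs)).2.2
  have hxμ : ‖x - G.mean k‖ ≤ Real.sqrt R * r := by
    refine abs_le_of_sq_le_sq' ?_ (by positivity) |>.2
    rw [mul_pow, Real.sq_sqrt hR.le]
    exact (norm_sq_le_mul_mahalanobisSq (G.cov_posDef k) (hup k) _ _).trans (by gcongr)
  have hB' : ∀ s, HasDerivAt (fun s => δ * Real.exp (c * (s - t)))
      (c * (δ * Real.exp (c * (s - t)))) s := by
    intro s
    have h1 : HasDerivAt (fun s : ℝ => c * (s - t)) c s := by
      simpa using ((hasDerivAt_id s).sub_const t).const_mul c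
    refine (h1.exp.const_mul δ).congr_deriv ?_
    ring
  -- The strict inequality of derivatives is required only when the distance equals the barrier; at
  -- such times the orbit is within δ of the affine one, hence in the ball of the score estimate. No
  -- prior confinement of the orbit is needed.
  have key := image_norm_le_of_norm_deriv_right_lt_deriv_boundary'
    (f := fun s => φ s x - G.contAffine s k x) (a := 0) (b := t)
    (f' := fun s => score (ρ s) (φ s x) -
      -matAct (G.contCov s k)⁻¹ (G.contAffine s k x - G.mean k))
    (B := fun s => δ * Real.exp (c * (s - t))) (B' := fun s => c * (δ * Real.exp (c * (s - t))))
    ?_ ?_ ?_ ?_ ?_ ?_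
  · have := key (right_mem_Icc.2 ht.1)
    simpa using this
  · intro s hs
    refine ContinuousWithinAt.sub ?_ ?_
    · exact ((hode x s (hsT s hs)).continuousWithinAt).mono hsT
    · exact (G.hasDerivAt_contAffine k (hpos s hs k) x).continuousAt.continuousWithinAt
  · intro s hs
    have hsI := Ico_subset_Icc_self hs
    refine HasDerivWithinAt.sub ?_ (G.hasDerivAt_contAffine k (hpos s hsI k) x).hasDerivWithinAt
    refine (hode x s (hsT s hsI)).mono_of_mem_nhdsWithin ?_
    filter_upwards [Ico_mem_nhdsGE (hsT s hsI).2] with u hu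
    exact ⟨hs.1.trans hu.1, hu.2⟩
  · simp only [h0, contAffine_zero, id, sub_self, norm_zero]
    positivity
  · exact fun s _ => (hB' s).continuousAt.continuousWithinAt
  · exact fun s _ => (hB' s).hasDerivWithinAt
  · intro s hs heq
    have hsI := Ico_subset_Icc_self hs
    set y := φ s x
    set z := G.contAffine s k x
    have hBδ : δ * Real.exp (c * (s - t)) ≤ δ :=
      mul_le_of_le_one_right hδ.le (Real.exp_le_one_iff.2
        (mul_nonpos_of_nonneg_of_nonpos hc0.le (by linarith [hs.2])))
    have hy : ‖y - G.mean k‖ ≤ δ + Real.sqrt R * r := by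
      calc ‖y - G.mean k‖ = ‖(y - z) + (z - G.mean k)‖ := by congr 1; abel
        _ ≤ ‖y - z‖ + ‖z - G.mean k‖ := norm_add_le _ _
        _ ≤ _ := add_le_add (heq.le.trans hBδ)
          ((G.norm_contAffine_sub_le hs.1 k (hpos s hsI k).posSemidef x).trans hxμ)
    -- Separation enters only at the center, so the orbit of `x` may leave Ω_k.
    have hμ : 1 - ε ≤ G.resp (G.contCov s) k (G.mean k) :=
      (hsep s hsI k).2.2 _ (mem_of_mem_nhds (hsep s hsI k).1)
    have h1 := hscore G (G.contCov s) (hpos s hsI) (hlow' s hsI) (hup' s hsI) k hk hμ y hy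
    have h2 := norm_matAct_inv_le (hpos s hsI k) hκ (hlow' s hsI k) (y - z)
    have e : score (ρ s) y - -matAct (G.contCov s k)⁻¹ (z - G.mean k)
        = (score (G.mixDensity (G.contCov s)) y + matAct (G.contCov s k)⁻¹ (y - G.mean k))
          - matAct (G.contCov s k)⁻¹ (y - z) := by
      rw [hscore_eq s hsI]
      simp only [matAct_sub]; abel
    rw [e]
    refine (norm_sub_le _ _).trans_lt ?_
    have h3 : η < δ * Real.exp (c * (s - t)) := by
      have h4 : Real.exp (-(c * R)) ≤ Real.exp (c * (s - t)) := by
        refine Real.exp_le_exp.2 ?_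
        have : c * (t - s) ≤ c * R := by
          have := hs.1
          gcongr; linarith
        linarith
      calc η < δ * Real.exp (-(c * R)) := by
            rw [hη]; gcongr; linarith
        _ ≤ _ := by gcongr
    rw [heq] at h2
    calc _ ≤ η + δ * Real.exp (c * (s - t)) / κ := add_le_add h1 h2
      _ < δ * Real.exp (c * (s - t)) + δ * Real.exp (c * (s - t)) / κ := by linarith
      _ = _ := by rw [hc]; ring

end GaussianMixture

end Continuous

end

/-! ### Assembly of the four claims. -/

theorem proposition1 (m K : ℕ) :
    -- the continuous DAE: exact pushforward
    (∀ (G : GaussianMixture m K) (T : ℝ) (φ : ℝ → Ground m → Ground m),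
      IsContinuousDAE G.law T φ →
      ∀ t ∈ Set.Ico 0 T, (∀ k, (G.contCov t k).PosDef) →
        G.law.map (φ t) = gaussianSum G.weight G.mean (G.contCov t)) ∧
    -- the ordinary DAE: approximate pushforward, and its action on the clusters
    (∀ R w r δ : ℝ, 0 < R → 0 < w → 0 < r → 0 < δ → ∃ ε : ℝ, 0 < ε ∧
      ∀ (G : GaussianMixture m K) (t : ℝ) (Ω : Fin K → Set (Ground m)),
        (∀ k, (R • (1 : Matrix (Fin m) (Fin m) ℝ) - G.cov k).PosSemidef) →
        0 ≤ t → t ≤ R →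
        G.WellSeparated (G.noisyCov t) Ω ε →
        MeasureTheory.levyProkhorovEDist (G.law.map (dae G.law t))
          (gaussianSum G.weight G.mean (G.daeCov t)) ≤ ENNReal.ofReal δ ∧
        ∀ k, w ≤ G.weight k → ∀ x ∈ Ω k, mahalanobisSq (G.mean k) (G.cov k) x ≤ r ^ 2 →
          ‖dae G.law t x - G.daeAffine t k x‖ ≤ δ) ∧
    -- the continuous DAE: its action on the clusters
    (∀ κ R w r δ : ℝ, 0 < κ → 0 < R → 0 < w → 0 < r → 0 < δ → ∃ ε : ℝ, 0 < ε ∧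
      ∀ (G : GaussianMixture m K) (T : ℝ) (φ : ℝ → Ground m → Ground m) (t : ℝ)
        (Ω : Fin K → Set (Ground m)),
        (∀ k, (R • (1 : Matrix (Fin m) (Fin m) ℝ) - G.cov k).PosSemidef) →
        IsContinuousDAE G.law T φ → t ∈ Set.Ico 0 T →
        (∀ k, (G.contCov t k - κ • (1 : Matrix (Fin m) (Fin m) ℝ)).PosSemidef) →
        (∀ s ∈ Set.Icc 0 t, G.WellSeparated (G.contCov s) Ω ε) →
        ∀ k, w ≤ G.weight k → ∀ x, mahalanobisSq (G.mean k) (G.cov k) x ≤ r ^ 2 →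
          ‖φ t x - G.contAffine t k x‖ ≤ δ) ∧
    -- the affine maps fix the cluster centers and are contractions
    (∀ (G : GaussianMixture m K) (t : ℝ) (k : Fin K), 0 < t →
      (G.daeAffine t k (G.mean k) = G.mean k ∧
        ∃ q : NNReal, ContractingWith q (G.daeAffine t k)) ∧
      ((G.contCov t k).PosDef →
        G.contAffine t k (G.mean k) = G.mean k ∧
        ∃ q : NNReal, ContractingWith q (G.contAffine t k))) := by
  refine ⟨fun G T φ h t ht hpos => G.map_of_isContinuousDAE h ht hpos, ?_, ?_, ?_⟩
  · intro R w r δ hR hw hr hδ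
    obtain ⟨ε₁, hε₁, h₁⟩ := GaussianMixture.exists_levyProkhorovEDist_dae_le m K hR hδ
    obtain ⟨ε₂, hε₂, h₂⟩ := GaussianMixture.exists_norm_dae_sub_daeAffine_le m K hR hw hr hδ
    refine ⟨min ε₁ ε₂, lt_min hε₁ hε₂, fun G t Ω hcov ht htR hsep => ⟨?_, ?_⟩⟩
    · exact h₁ G t Ω hcov ht htR (hsep.mono (min_le_left _ _))
    · exact fun k hk x hx hd => h₂ G t hcov ht htR k x hk hd
        (((hsep.mono (min_le_right _ _)) k).2.2 x hx)
  · intro κ R w r δ hκ hR hw hr hδ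
    exact GaussianMixture.exists_norm_flow_sub_contAffine_le m K hκ hR hw hr hδ
  · intro G t k ht
    exact ⟨⟨by simp [GaussianMixture.daeAffine], G.contractingWith_daeAffine ht k⟩,
      fun h => ⟨by simp [GaussianMixture.contAffine], G.contractingWith_contAffine ht k h⟩⟩
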